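/- Let $n\ge 2$. For $E\subset\mathbb{R}^n$, $x\in\mathbb{R}^n$, $r>0$ put $E_{x,r}=r^{-1}(E-x)$ and let $d_E(y)=\operatorname{dist}(y,E)-\operatorname{dist}(y,\mathbb{R}^n\setminus E)$ be the signed distance function. Let $\Omega\subset\mathbb{R}^n$ be a domain with finite perimeter, i.e. an open connected set which contains every point $x$ such that $|B_r(x)\setminus\Omega|=0$ for some $r>0$, and such that $P(\Omega)=\sup\{\int_\Omega \operatorname{div} g\,dx : g\in C^1_c(\mathbb{R}^n;\mathbb{R}^n),\ \|g\|_\infty\le 1\}<\infty$. Let $D\chi_\Omega$ be the distributional gradient of $\chi_\Omega$, a vector-valued Radon measure with total variation $|D\chi_\Omega|$. The reduced boundary $\partial^*\Omega$ is the set of points $x$ at which $\Omega$ has neither density $0$ nor density $1$ and for which the limit $\lim_{r\to0^+} D\chi_\Omega(B_r(x))/|D\chi_\Omega|(B_r(x)) = -\nu_\Omega(x)$ exists and is a unit vector. For $x\in\partial^*\Omega$ let $H_x=\{y\in\mathbb{R}^n : y\cdot\nu_\Omega(x)<0\}$ be the tangent half-space to $\Omega$ at $x$. The super-reduced boundary $\partial^{**}\Omega$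 is the set of $x\in\partial^*\Omega$ such that $d_{\Omega_{x,r}}\to d_{H_x}$ locally uniformly on $H_x$ as $r\to0^+$. Let $x\in\partial^*\Omega$. Then $x\in\partial^{**}\Omega$ if and only if for all $\varepsilon,R>0$ there exists $r_0>0$ such that for all $0<r<r_0$ and all $y\in\partial\Omega_{x,r}\cap H_x$ with $|y|\le R$ one has $-d_{H_x}(y)\le\varepsilon|y|$. -/

import Mathlib

open MeasureTheory Filter Topology Set
open scoped ENNReal

noncomputable section

namespace GMT

/-- Euclidean `n`-space. -/
abbrev Eucl (n : ℕ) := EuclideanSpace ℝ (Fin n)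

/-- The rescaled set `E_{x,r} = r⁻¹ (E - x)`. -/
def rescale {n : ℕ} (E : Set (Eucl n)) (x : Eucl n) (r : ℝ) : Set (Eucl n) :=
  (fun y => r⁻¹ • (y - x)) '' E

/-- The signed distance function `d_E(y) = dist(y, E) - dist(y, ℝⁿ \ E)`. -/
def signedDistFun {n : ℕ} (E : Set (Eucl n)) (y : Eucl n) : ℝ :=
  Metric.infDist y E - Metric.infDist y Eᶜ

/-- The open half-space `H_ν` through `0` with exterior normal `ν`. -/
def halfSpace {n : ℕ} (ν : Eucl n) : Set (Eucl n) :=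
  {y | inner ℝ y ν < 0}

/-- The divergence of a vector field. -/
def divergence {n : ℕ} (g : Eucl n → Eucl n) (x : Eucl n) : ℝ :=
  ∑ i : Fin n, (fderiv ℝ g x (EuclideanSpace.single i 1)) i

/-- `g ∈ C¹_c(U; ℝⁿ)`. -/
structure IsTestField {n : ℕ} (U : Set (Eucl n)) (g : Eucl n → Eucl n) : Prop where
  contDiff : ContDiff ℝ 1 g
  compact : HasCompactSupport g
  support : tsupport g ⊆ U

/-- The perimeter `P(E; U)`, the supremum of `∫_U χ_E div g` over `g ∈ C¹_c(U; ℝⁿ)` with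
`‖g‖_∞ ≤ 1`. The supremum is nonnegative (take `g = 0`), so truncating negative values
by `ENNReal.ofReal` does not change it. -/
def perimeter {n : ℕ} (E U : Set (Eucl n)) : ℝ≥0∞ :=
  ⨆ (g : Eucl n → Eucl n) (_ : IsTestField U g) (_ : ∀ x, ‖g x‖ ≤ 1),
    ENNReal.ofReal (∫ x in U, E.indicator (fun _ => (1 : ℝ)) x * divergence g x)

/-- A domain: an open connected set that coincides with its measure-theoretic interior. -/
structure IsMeasureDomain {n : ℕ} (Ω : Set (Eucl n)) : Prop where
  isOpen : IsOpen Ω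
  isConnected : IsConnected Ω
  mem_of_ball : ∀ x : Eucl n, ∀ r : ℝ, 0 < r → volume (Metric.ball x r \ Ω) = 0 → x ∈ Ω

/-- The set `E^(α)` of points of density `α` of `E`. -/
def densityPoints {n : ℕ} (E : Set (Eucl n)) (α : ℝ) : Set (Eucl n) :=
  {x | Tendsto (fun r : ℝ => volume.real (E ∩ Metric.ball x r) /
    (volume.real (Metric.ball (0 : Eucl n) 1) * r ^ n)) (𝓝[>] 0) (𝓝 α)}

/-- The essential boundary `∂ᵉE = ℝⁿ \ (E^(0) ∪ E^(1))`. -/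
def essentialBoundary {n : ℕ} (E : Set (Eucl n)) : Set (Eucl n) :=
  (densityPoints E 0 ∪ densityPoints E 1)ᶜ

/-- The distributional gradient `Dχ_E` is the vector-valued Radon measure `σ m`, where `m` is a
(locally finite, nonnegative) Radon measure and `|σ| = 1` holds `m`-almost everywhere; thus
`m = |Dχ_E|` is its total variation. The identity is `∫ χ_E div g = - ∫ g · dDχ_E`. -/
structure IsGradientMeasure {n : ℕ} (E : Set (Eucl n)) (m : Measure (Eucl n))
    (σ : Eucl n → Eucl n) : Prop where
  locallyFinite : IsLocallyFiniteMeasure m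
  measurable : Measurable σ
  norm_eq_one : ∀ᵐ x ∂m, ‖σ x‖ = 1
  integral_eq : ∀ g : Eucl n → Eucl n, IsTestField univ g →
    ∫ x, E.indicator (fun _ => (1 : ℝ)) x * divergence g x = - ∫ x, inner ℝ (g x) (σ x) ∂m

/-- `ν` is a unit vector and `Dχ_E(B_r(x)) / |Dχ_E|(B_r(x)) → -ν` as `r → 0⁺`. -/
def IsOuterNormal {n : ℕ} (E : Set (Eucl n)) (x ν : Eucl n) : Prop :=
  ‖ν‖ = 1 ∧ ∃ (m : Measure (Eucl n)) (σ : Eucl n → Eucl n), IsGradientMeasure E m σ ∧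
    Tendsto (fun r : ℝ => (m.real (Metric.ball x r))⁻¹ • ∫ y in Metric.ball x r, σ y ∂m)
      (𝓝[>] 0) (𝓝 (-ν))

/-- The reduced boundary `∂*E`. -/
def reducedBoundary {n : ℕ} (E : Set (Eucl n)) : Set (Eucl n) :=
  {x | x ∈ essentialBoundary E ∧ ∃ ν, IsOuterNormal E x ν}

open Classical in
/-- The measure-theoretic exterior normal `ν_E(x)` (meaningful for `x ∈ ∂*E`). -/
def outerNormal {n : ℕ} (E : Set (Eucl n)) (x : Eucl n) : Eucl n :=
  if h : ∃ ν, IsOuterNormal E x ν then h.choose else 0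

/-- The tangent half-space `H_x` to `E` at `x ∈ ∂*E`. -/
def tangentHalfSpace {n : ℕ} (E : Set (Eucl n)) (x : Eucl n) : Set (Eucl n) :=
  halfSpace (outerNormal E x)

/-- The super-reduced boundary `∂**E`: the points `x ∈ ∂*E` such that the signed distance
functions of `E_{x,r}` converge, as `r → 0⁺`, to that of `H_x`, locally uniformly on `H_x`. -/
def superReducedBoundary {n : ℕ} (E : Set (Eucl n)) : Set (Eucl n) :=
  {x | x ∈ reducedBoundary E ∧
    TendstoLocallyUniformlyOn (fun r : ℝ => signedDistFun (rescale E x r))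
      (signedDistFun (tangentHalfSpace E x)) (𝓝[>] 0) (tangentHalfSpace E x)}

end GMT

end

noncomputable section

namespace GMT

variable {n : ℕ} {E : Set (Eucl n)} {m : Measure (Eucl n)} {σ : Eucl n → Eucl n}
  {x ν : Eucl n}

/-! Necessity is a scaling argument. If boundary points y lay deep in `H_x` relative to |y|, then
dividing by |y| would put a boundary point of another blow-up in a fixed compact subset of `H_x`.
There the signed distance of the blow-up vanishes, while that of `H_x` stays at most -ε.

Sufficiency needs one measure-theoretic fact (`eventually_ball_inter_nonempty`): at small scales `Ω`
meets every ball of fixed relative size centred in the closure of `H_x`, and the complement, whose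
normal is -ν, meets every such ball on the other side. By the cone condition, a ball in `H_x` away
from `∂H_x` contains no boundary point of the blow-up. It is connected and meets the blow-up, hence
lies inside it. Complement points near `∂H_x` bound the distance from above.

The fact is proved without compactness of blow-ups. Existence of the normal makes the mean of |σ +
ν| small on small balls (`exists_hasExcessLE`). Hence E is almost monotone in inward directions:
translation by h with h · ν ≤ 0 moves little volume out of E
(`IsGradientMeasure.measureReal_exit_le`). If E filled too little of one small ball, this would
force geometric decay of its density (`HasExcessLE.volume_decay`), so x would have density 0. Thus E
has positive lower density at x, and a translation by r p carries a portion of E near x into the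
ball around x + r p. -/

theorem IsGradientMeasure.integrableOn_ball_norm_add (hE : IsGradientMeasure E m σ)
    (x ν : Eucl n) (r : ℝ) : IntegrableOn (fun y => ‖σ y + ν‖) (Metric.ball x r) m := by
  have := hE.locallyFinite
  have hfin : m (Metric.ball x r) < ∞ := measure_ball_lt_top
  refine Measure.integrableOn_of_bounded (M := 1 + ‖ν‖) hfin.ne
    ((hE.measurable.add_const ν).norm.aestronglyMeasurable) ?_
  filter_upwards [ae_restrict_of_ae hE.norm_eq_one] with y hy
  rw [norm_norm]
  exact (norm_add_le _ _).trans (by rw [hy])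

theorem IsGradientMeasure.integrableOn_ball (hE : IsGradientMeasure E m σ)
    (x : Eucl n) (r : ℝ) : IntegrableOn σ (Metric.ball x r) m := by
  have := hE.locallyFinite
  have hfin : m (Metric.ball x r) < ∞ := measure_ball_lt_top
  refine Measure.integrableOn_of_bounded (M := 1) hfin.ne
    (hE.measurable.aestronglyMeasurable) ?_
  filter_upwards [ae_restrict_of_ae hE.norm_eq_one] with y hy
  exact hy.le

/-! ### Smallness of the excess. -/

/-- The `L¹` excess of `(m, σ)` with respect to the constant direction `-ν` is at most `η` on all
balls about `x` with radius less than `r₁`. -/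
def HasExcessLE (m : Measure (Eucl n)) (σ : Eucl n → Eucl n) (x ν : Eucl n) (η r₁ : ℝ) : Prop :=
  ∀ s, 0 < s → s < r₁ → ∫ y in Metric.ball x s, ‖σ y + ν‖ ∂m ≤ η * m.real (Metric.ball x s)

/-- For unit vectors |a + ν|² = 2 (1 + a · ν), and t ≤ η/2 + t²/(2η). The right side is affine in a,
so its average is determined by the average of a. -/
theorem norm_add_le_of_norm_eq_one {a ν : Eucl n} (ha : ‖a‖ = 1) (hν : ‖ν‖ = 1) {η : ℝ}
    (hη : 0 < η) : ‖a + ν‖ ≤ η / 2 + η⁻¹ * (1 + inner ℝ a ν) := by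
  have h : ‖a + ν‖ ^ 2 = 2 * (1 + inner ℝ a ν) := by
    rw [norm_add_sq_real, ha, hν]; ring
  have h1 : (1 + inner ℝ a ν) = ‖a + ν‖ ^ 2 / 2 := by linarith
  rw [h1]
  have h2 : η / 2 + η⁻¹ * (‖a + ν‖ ^ 2 / 2) - ‖a + ν‖ = η⁻¹ / 2 * (η - ‖a + ν‖) ^ 2 := by
    field_simp; ring
  have : 0 ≤ η⁻¹ / 2 * (η - ‖a + ν‖) ^ 2 := by positivity
  linarith

theorem exists_hasExcessLE (hE : IsGradientMeasure E m σ) (hν : ‖ν‖ = 1)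
    (hlim : Tendsto (fun r : ℝ => (m.real (Metric.ball x r))⁻¹ •
      ∫ y in Metric.ball x r, σ y ∂m) (𝓝[>] 0) (𝓝 (-ν))) {η : ℝ} (hη : 0 < η) :
    ∃ r₁ > 0, HasExcessLE m σ x ν η r₁ := by
  have := hE.locallyFinite
  have h1 : Tendsto (fun r : ℝ => 1 + inner ℝ ((m.real (Metric.ball x r))⁻¹ •
      ∫ y in Metric.ball x r, σ y ∂m) ν) (𝓝[>] 0) (𝓝 0) := by
    have := (hlim.inner (𝕜 := ℝ) (tendsto_const_nhds (x := ν))).const_add 1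
    simpa [real_inner_self_eq_norm_sq, hν] using this
  -- The threshold η²/2 becomes η/2 after multiplication by η⁻¹; the other η/2 is the constant term
  -- of the pointwise bound.
  have h2 := h1.eventually (gt_mem_nhds (show (0 : ℝ) < η ^ 2 / 2 by positivity))
  obtain ⟨r₁, hr₁, H⟩ := mem_nhdsGT_iff_exists_Ioo_subset.1 h2
  refine ⟨r₁, hr₁, fun s hs hsr => ?_⟩
  have hs' : 1 + inner ℝ ((m.real (Metric.ball x s))⁻¹ •
      ∫ y in Metric.ball x s, σ y ∂m) ν < η ^ 2 / 2 := H ⟨hs, hsr⟩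
  have hfin : m (Metric.ball x s) < ∞ := measure_ball_lt_top
  have hint := hE.integrableOn_ball x s
  have hconst (c : ℝ) : IntegrableOn (fun _ => c) (Metric.ball x s) m :=
    integrableOn_const hfin.ne
  have hinn : IntegrableOn (fun y => inner ℝ (σ y) ν) (Metric.ball x s) m := hint.inner_const ν
  have hbd : ∫ y in Metric.ball x s, ‖σ y + ν‖ ∂m ≤
      ∫ y in Metric.ball x s, (η / 2 + η⁻¹ * (1 + inner ℝ (σ y) ν)) ∂m := by
    refine integral_mono_ae (hE.integrableOn_ball_norm_add x ν s)
      ((hconst _).add (((hconst _).add hinn).const_mul _)) ?_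
    filter_upwards [ae_restrict_of_ae hE.norm_eq_one] with y hy
    exact norm_add_le_of_norm_eq_one hy hν hη
  have hcomp : ∫ y in Metric.ball x s, (η / 2 + η⁻¹ * (1 + inner ℝ (σ y) ν)) ∂m =
      m.real (Metric.ball x s) * (η / 2) + η⁻¹ * (m.real (Metric.ball x s) +
        inner ℝ (∫ y in Metric.ball x s, σ y ∂m) ν) := by
    have hadd : IntegrableOn (fun y => 1 + inner ℝ (σ y) ν) (Metric.ball x s) m :=
      (hconst 1).add hinn
    rw [integral_add (hconst _) (hadd.const_mul _), integral_const_mul,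
      integral_add (hconst _) hinn]
    congr 1
    · simp
    · congr 2
      · simp
      · exact (integral_congr_ae (ae_of_all _ fun y => real_inner_comm _ _)).trans
          ((integral_inner (𝕜 := ℝ) hint.integrable ν).trans (real_inner_comm _ _))
  rw [hcomp] at hbd
  rcases eq_or_lt_of_le (measureReal_nonneg (μ := m) (s := Metric.ball x s)) with h0 | hpos
  · have : m.restrict (Metric.ball x s) = 0 := by
      rw [Measure.restrict_eq_zero]
      simpa [Measure.real, ENNReal.toReal_eq_zero_iff, hfin.ne] using h0.symm
    simp [this, ← h0]
  · have h3 : m.real (Metric.ball x s) + inner ℝ (∫ y in Metric.ball x s, σ y ∂m) ν =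
        m.real (Metric.ball x s) * (1 + inner ℝ ((m.real (Metric.ball x s))⁻¹ •
          ∫ y in Metric.ball x s, σ y ∂m) ν) := by
      rw [real_inner_smul_left]; field_simp
    rw [h3] at hbd
    have h4 : η⁻¹ * (m.real (Metric.ball x s) * (1 + inner ℝ ((m.real (Metric.ball x s))⁻¹ •
          ∫ y in Metric.ball x s, σ y ∂m) ν)) ≤ η⁻¹ * (m.real (Metric.ball x s) * (η ^ 2 / 2)) := by
      gcongr
    have h5 : η⁻¹ * (m.real (Metric.ball x s) * (η ^ 2 / 2)) =
      m.real (Metric.ball x s) * (η / 2) := by field_simp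
    linarith

/-! ### Radial cutoffs and testing in a fixed direction. -/

/-- The radial `C¹` cutoff `(4ρ² - |y - x|²)₊²`, whose superlevel sets are balls. -/
def radialCutoff (x : Eucl n) (ρ : ℝ) (y : Eucl n) : ℝ :=
  (max 0 (4 * ρ ^ 2 - ‖y - x‖ ^ 2)) ^ 2

theorem hasDerivAt_max_zero_sq (t : ℝ) :
    HasDerivAt (fun t : ℝ => (max 0 t) ^ 2) (2 * max 0 t) t := by
  rcases lt_trichotomy t 0 with h | h | h
  · rw [max_eq_left h.le, mul_zero]
    refine (hasDerivAt_const t (0 : ℝ)).congr_of_eventuallyEq ?_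
    filter_upwards [gt_mem_nhds h] with s hs
    simp [max_eq_left hs.le]
  · subst h
    rw [hasDerivAt_iff_isLittleO]
    simp only [max_self, mul_zero, smul_zero, sub_zero, ne_eq, OfNat.ofNat_ne_zero,
      not_false_eq_true, zero_pow]
    -- At the corner the function is bounded by t², which is o(t).
    refine Asymptotics.IsBigO.trans_isLittleO (g := fun t : ℝ => t ^ 2) ?_ ?_
    · refine Asymptotics.isBigO_of_le _ fun t => ?_
      rw [norm_pow, norm_pow]
      gcongr
      rw [Real.norm_eq_abs, Real.norm_eq_abs, abs_of_nonneg (le_max_left _ _)]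
      exact max_le (abs_nonneg _) (le_abs_self _)
    · simpa using Asymptotics.isLittleO_pow_id (𝕜 := ℝ) one_lt_two
  · rw [max_eq_right h.le]
    have := hasDerivAt_pow 2 t
    refine (HasDerivAt.congr_of_eventuallyEq (by simpa using this) ?_)
    filter_upwards [lt_mem_nhds h] with s hs
    simp [max_eq_right hs.le]

theorem contDiff_max_zero_sq : ContDiff ℝ 1 (fun t : ℝ => (max 0 t) ^ 2) := by
  rw [contDiff_one_iff_deriv]
  refine ⟨fun t => (hasDerivAt_max_zero_sq t).differentiableAt, ?_⟩
  rw [funext fun t => (hasDerivAt_max_zero_sq t).deriv]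
  fun_prop

theorem contDiff_radialCutoff (x : Eucl n) (ρ : ℝ) : ContDiff ℝ 1 (radialCutoff x ρ) :=
  contDiff_max_zero_sq.comp
    (contDiff_const.sub ((contDiff_id.sub contDiff_const).norm_sq ℝ))

theorem radialCutoff_nonneg (x : Eucl n) (ρ : ℝ) (y : Eucl n) : 0 ≤ radialCutoff x ρ y :=
  sq_nonneg _

theorem radialCutoff_eq_zero {x : Eucl n} {ρ : ℝ} (hρ : 0 ≤ ρ) {y : Eucl n}
    (hy : y ∉ Metric.ball x (2 * ρ)) : radialCutoff x ρ y = 0 := by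
  rw [Metric.mem_ball, dist_eq_norm, not_lt] at hy
  have : (2 * ρ) ^ 2 ≤ ‖y - x‖ ^ 2 := by gcongr
  rw [radialCutoff, max_eq_left (by linarith)]
  simp

theorem fderiv_radialCutoff (x : Eucl n) (ρ : ℝ) (y v : Eucl n) :
    fderiv ℝ (radialCutoff x ρ) y v =
      2 * max 0 (4 * ρ ^ 2 - ‖y - x‖ ^ 2) * (-(2 * inner ℝ (y - x) v)) := by
  have h1 : HasFDerivAt (fun y : Eucl n => 4 * ρ ^ 2 - ‖y - x‖ ^ 2)
      (-(2 • (innerSL ℝ (y - x)))) y := by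
    have := ((hasFDerivAt_id (𝕜 := ℝ) y).sub_const x).norm_sq
    simpa using this.const_sub (4 * ρ ^ 2)
  have := (hasDerivAt_max_zero_sq (4 * ρ ^ 2 - ‖y - x‖ ^ 2)).comp_hasFDerivAt y h1
  have h2 : HasFDerivAt (radialCutoff x ρ) _ y := this
  rw [h2.fderiv]
  simp [inner_sub_left]

theorem abs_fderiv_radialCutoff_le {ρ : ℝ} (hρ : 0 ≤ ρ) {v : Eucl n} (hv : ‖v‖ = 1)
    (x y : Eucl n) : |fderiv ℝ (radialCutoff x ρ) y v| ≤
      (Metric.ball x (2 * ρ)).indicator (fun _ => 32 * ρ ^ 3) y := by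
  rw [fderiv_radialCutoff]
  by_cases hy : y ∈ Metric.ball x (2 * ρ)
  · rw [indicator_of_mem hy]
    rw [Metric.mem_ball, dist_eq_norm] at hy
    have h1 : |inner ℝ (y - x) v| ≤ 2 * ρ := by
      refine (abs_real_inner_le_norm _ _).trans ?_
      rw [hv, mul_one]; exact hy.le
    have h2 : max 0 (4 * ρ ^ 2 - ‖y - x‖ ^ 2) ≤ 4 * ρ ^ 2 :=
      max_le (by positivity) (by nlinarith [sq_nonneg ‖y - x‖])
    rw [abs_mul, abs_mul, abs_neg, abs_mul,
      abs_of_nonneg (a := max 0 (4 * ρ ^ 2 - ‖y - x‖ ^ 2)) (le_max_left _ _)]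
    simp only [Nat.abs_ofNat]
    calc 2 * max 0 (4 * ρ ^ 2 - ‖y - x‖ ^ 2) * (2 * |inner ℝ (y - x) v|)
        ≤ 2 * (4 * ρ ^ 2) * (2 * (2 * ρ)) := by gcongr
      _ = _ := by ring
  · rw [indicator_of_notMem hy]
    rw [Metric.mem_ball, dist_eq_norm, not_lt] at hy
    have : (2 * ρ) ^ 2 ≤ ‖y - x‖ ^ 2 := by gcongr
    rw [max_eq_left (by linarith)]
    simp

theorem hasCompactSupport_of_eq_zero_off_ball {F : Type*} [Zero F] {φ : Eucl n → F} {x : Eucl n}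
    {r : ℝ} (h : ∀ y, y ∉ Metric.ball x r → φ y = 0) : HasCompactSupport φ :=
  HasCompactSupport.intro (isCompact_closedBall x r) fun y hy =>
    h y fun hy' => hy (Metric.ball_subset_closedBall hy')

theorem divergence_smul_const {φ : Eucl n → ℝ} (hφ : Differentiable ℝ φ) (v y : Eucl n) :
    divergence (fun z => φ z • v) y = fderiv ℝ φ y v := by
  have h : HasFDerivAt (fun z => φ z • v) ((fderiv ℝ φ y).smulRight v) y :=
    (hφ y).hasFDerivAt.smul_const v
  rw [divergence, h.fderiv]
  conv_rhs => rw [← (EuclideanSpace.basisFun (Fin n) ℝ).sum_repr v, map_sum]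
  refine Finset.sum_congr rfl fun i _ => ?_
  simp [mul_comm]

/-- The defining identity of the gradient measure, for test fields of constant direction. -/
theorem IsGradientMeasure.integral_fderiv_eq (hE : IsGradientMeasure E m σ) {φ : Eucl n → ℝ}
    (hφ : ContDiff ℝ 1 φ) (hc : HasCompactSupport φ) (v : Eucl n) :
    ∫ y, E.indicator (fun _ => (1 : ℝ)) y * fderiv ℝ φ y v = - ∫ y, φ y * inner ℝ v (σ y) ∂m := by
  have ht : IsTestField univ (fun z => φ z • v) :=
    ⟨hφ.smul contDiff_const, hc.smul_right, subset_univ _⟩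
  have := hE.integral_eq _ ht
  simp_rw [divergence_smul_const (hφ.differentiable one_ne_zero), real_inner_smul_left] at this
  exact this

theorem lt_radialCutoff_eq_ball_or_empty (x : Eucl n) {ρ : ℝ} (hρ : 0 < ρ) {t : ℝ} (ht : 0 < t) :
    (∃ s, 0 < s ∧ s ≤ 2 * ρ ∧ {y | t < radialCutoff x ρ y} = Metric.ball x s) ∨
      {y | t < radialCutoff x ρ y} = ∅ := by
  have key (y : Eucl n) : t < radialCutoff x ρ y ↔ ‖y - x‖ ^ 2 < 4 * ρ ^ 2 - √t := by
    have hs := Real.sqrt_pos.2 ht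
    rw [radialCutoff, ← Real.sqrt_lt_sqrt_iff ht.le, Real.sqrt_sq (le_max_left _ _), lt_max_iff]
    constructor
    · rintro (h | h) <;> linarith
    · intro h; right; linarith
  rcases lt_or_ge 0 (4 * ρ ^ 2 - √t) with h | h
  · refine Or.inl ⟨√(4 * ρ ^ 2 - √t), Real.sqrt_pos.2 h, ?_, ?_⟩
    · rw [Real.sqrt_le_left (by positivity)]
      nlinarith [Real.sqrt_nonneg t]
    · ext y
      rw [mem_ofPred_eq, key, Metric.mem_ball, dist_eq_norm, Real.lt_sqrt (norm_nonneg _)]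
  · refine Or.inr (eq_empty_of_forall_notMem fun y hy => ?_)
    have := (key y).1 hy
    nlinarith [sq_nonneg ‖y - x‖]

/-- The excess is controlled only on balls about x. By the layer-cake formula this suffices, since
every superlevel set of the cutoff at a positive level is such a ball or empty. -/
theorem HasExcessLE.integral_radialCutoff_mul_le (hE : IsGradientMeasure E m σ) {η r₁ ρ : ℝ}
    (hη : 0 ≤ η) (hex : HasExcessLE m σ x ν η r₁) (hρ : 0 < ρ) (hρr : 2 * ρ < r₁) :
    ∫ y, radialCutoff x ρ y * ‖σ y + ν‖ ∂m ≤ η * ∫ y, radialCutoff x ρ y ∂m := by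
  have := hE.locallyFinite
  have hcont : Continuous (radialCutoff x ρ) := (contDiff_radialCutoff x ρ).continuous
  have hcs : HasCompactSupport (radialCutoff x ρ) :=
    hasCompactSupport_of_eq_zero_off_ball fun y hy => radialCutoff_eq_zero hρ.le hy
  have hint : Integrable (radialCutoff x ρ) m := hcont.integrable_of_hasCompactSupport hcs
  set w : Eucl n → ℝ≥0∞ := fun y => ENNReal.ofReal ‖σ y + ν‖ with hw
  have hwm : Measurable w := ((hE.measurable.add_const ν).norm).ennreal_ofReal
  have hball (s : ℝ) (hs : 0 < s) (hs' : s ≤ 2 * ρ) :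
      m.withDensity w (Metric.ball x s) ≤ ENNReal.ofReal η * m (Metric.ball x s) := by
    have hfin : m (Metric.ball x s) < ∞ := measure_ball_lt_top
    rw [withDensity_apply _ Metric.isOpen_ball.measurableSet,
      ← ofReal_integral_eq_lintegral_ofReal (hE.integrableOn_ball_norm_add x ν s)
        (ae_of_all _ fun y => norm_nonneg _), ← ofReal_measureReal hfin.ne,
      ← ENNReal.ofReal_mul hη]
    exact ENNReal.ofReal_le_ofReal (hex s hs (hs'.trans_lt hρr))
  have hlin : ∫⁻ y, ENNReal.ofReal (radialCutoff x ρ y) ∂(m.withDensity w) ≤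
      ENNReal.ofReal η * ∫⁻ y, ENNReal.ofReal (radialCutoff x ρ y) ∂m := by
    rw [lintegral_eq_lintegral_meas_lt _ (ae_of_all _ (radialCutoff_nonneg x ρ))
        hcont.measurable.aemeasurable,
      lintegral_eq_lintegral_meas_lt _ (ae_of_all _ (radialCutoff_nonneg x ρ))
        hcont.measurable.aemeasurable, ← lintegral_const_mul' _ _ ENNReal.ofReal_ne_top]
    refine setLIntegral_mono' measurableSet_Ioi fun t ht => ?_
    rcases lt_radialCutoff_eq_ball_or_empty x hρ ht with ⟨s, hs, hs', h⟩ | h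
    · rw [h]; exact hball s hs hs'
    · simp [h]
  rw [lintegral_withDensity_eq_lintegral_mul _ hwm hcont.measurable.ennreal_ofReal] at hlin
  rw [integral_eq_lintegral_of_nonneg_ae
      (ae_of_all _ fun y => mul_nonneg (radialCutoff_nonneg x ρ y) (norm_nonneg _))
      ((hcont.measurable.mul (hE.measurable.add_const ν).norm).aestronglyMeasurable),
    integral_eq_lintegral_of_nonneg_ae (ae_of_all _ (radialCutoff_nonneg x ρ))
      hcont.aestronglyMeasurable]
  have hfin : ∫⁻ y, ENNReal.ofReal (radialCutoff x ρ y) ∂m ≠ ∞ :=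
    (hint.lintegral_lt_top).ne
  have := ENNReal.toReal_mono (ENNReal.mul_ne_top ENNReal.ofReal_ne_top hfin) hlin
  rw [ENNReal.toReal_mul, ENNReal.toReal_ofReal hη] at this
  convert this using 3
  funext y
  simp only [Pi.mul_apply, hw]
  rw [mul_comm, ENNReal.ofReal_mul (norm_nonneg _)]

/-! ### Perimeter controlled by volume. -/

/-- Where the excess is small, the perimeter in a ball is controlled by the volume in the
ball of twice the radius. -/
theorem HasExcessLE.measureReal_ball_le (hE : IsGradientMeasure E m σ) (hν : ‖ν‖ = 1)
    (hmeas : MeasurableSet E) {η r₁ ρ : ℝ} (hη : 0 ≤ η) (hη' : η ≤ 1 / 2)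
    (hex : HasExcessLE m σ x ν η r₁) (hρ : 0 < ρ) (hρr : 2 * ρ < r₁) :
    m.real (Metric.ball x ρ) ≤ 8 / ρ * volume.real (E ∩ Metric.ball x (2 * ρ)) := by
  have := hE.locallyFinite
  have hcont : Continuous (radialCutoff x ρ) := (contDiff_radialCutoff x ρ).continuous
  have hzero (y) (hy : y ∉ Metric.ball x (2 * ρ)) : radialCutoff x ρ y = 0 :=
    radialCutoff_eq_zero hρ.le hy
  have hcs : HasCompactSupport (radialCutoff x ρ) := hasCompactSupport_of_eq_zero_off_ball hzero
  have hint : Integrable (radialCutoff x ρ) m := hcont.integrable_of_hasCompactSupport hcs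
  have hnormint : Integrable (fun y => radialCutoff x ρ y * ‖σ y + ν‖) m := by
    refine (hint.mul_const (1 + ‖ν‖)).mono'
      (hcont.measurable.mul (hE.measurable.add_const ν).norm).aestronglyMeasurable ?_
    filter_upwards [hE.norm_eq_one] with y hy
    rw [norm_mul, norm_norm, Real.norm_of_nonneg (radialCutoff_nonneg x ρ y)]
    exact mul_le_mul_of_nonneg_left ((norm_add_le _ _).trans (by rw [hy]))
      (radialCutoff_nonneg x ρ y)
  have hinnint : Integrable (fun y => radialCutoff x ρ y * inner ℝ ν (σ y)) m := by
    refine hint.mono' (hcont.measurable.mul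
      (measurable_const.inner hE.measurable)).aestronglyMeasurable ?_
    filter_upwards [hE.norm_eq_one] with y hy
    rw [norm_mul, Real.norm_of_nonneg (radialCutoff_nonneg x ρ y)]
    refine mul_le_of_le_one_right (radialCutoff_nonneg x ρ y) ?_
    exact (norm_inner_le_norm _ _).trans (by rw [hy, hν, mul_one])
  -- Pointwise 1 ≤ -ν · σ + |σ + ν|. The first term becomes a volume integral by the gradient
  -- identity; the second is at most half the left side and is absorbed.
  have hsplit : ∫ y, radialCutoff x ρ y ∂m ≤
      (- ∫ y, radialCutoff x ρ y * inner ℝ ν (σ y) ∂m) +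
        ∫ y, radialCutoff x ρ y * ‖σ y + ν‖ ∂m := by
    rw [← integral_neg, ← integral_add hinnint.fun_neg hnormint]
    refine integral_mono hint (hinnint.fun_neg.add hnormint) fun y => ?_
    have h1 : 1 + inner ℝ ν (σ y) ≤ ‖σ y + ν‖ := by
      have := real_inner_le_norm ν (σ y + ν)
      rw [inner_add_right, real_inner_self_eq_norm_sq, hν] at this
      linarith
    have := mul_le_mul_of_nonneg_left h1 (radialCutoff_nonneg x ρ y)
    simp only
    linarith
  rw [← hE.integral_fderiv_eq (contDiff_radialCutoff x ρ) hcs ν] at hsplit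
  have hEmeas : MeasurableSet (E ∩ Metric.ball x (2 * ρ)) :=
    hmeas.inter Metric.isOpen_ball.measurableSet
  have hEfin : volume (E ∩ Metric.ball x (2 * ρ)) ≠ ∞ :=
    ((measure_mono inter_subset_right).trans_lt measure_ball_lt_top).ne
  have hvol : ∫ y, E.indicator (fun _ => (1 : ℝ)) y * fderiv ℝ (radialCutoff x ρ) y ν ≤
      32 * ρ ^ 3 * volume.real (E ∩ Metric.ball x (2 * ρ)) := by
    have : ∫ y, (E ∩ Metric.ball x (2 * ρ)).indicator (fun _ => 32 * ρ ^ 3) y =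
        32 * ρ ^ 3 * volume.real (E ∩ Metric.ball x (2 * ρ)) := by
      rw [integral_indicator_const _ hEmeas, smul_eq_mul, mul_comm]
    rw [← this]
    refine (Real.le_norm_self _).trans (norm_integral_le_of_norm_le
      ((integrable_indicator_iff hEmeas).2 (integrableOn_const (C := 32 * ρ ^ 3) hEfin)) (ae_of_all _ fun y => ?_))
    have h1 := abs_fderiv_radialCutoff_le hρ.le hν x y
    by_cases hy : y ∈ E
    · have h2 : (E ∩ Metric.ball x (2 * ρ)).indicator (fun _ => 32 * ρ ^ 3) y =
          (Metric.ball x (2 * ρ)).indicator (fun _ => 32 * ρ ^ 3) y := by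
        simp [indicator, hy]
      rw [h2, indicator_of_mem hy, one_mul]
      exact h1
    · rw [indicator_of_notMem hy, zero_mul, norm_zero]
      exact indicator_nonneg (fun _ _ => by positivity) _
  have hlow : 9 * ρ ^ 4 * m.real (Metric.ball x ρ) ≤ ∫ y, radialCutoff x ρ y ∂m := by
    have hfin : m (Metric.ball x ρ) < ∞ := measure_ball_lt_top
    have : ∫ y, (Metric.ball x ρ).indicator (fun _ => 9 * ρ ^ 4) y ∂m =
        9 * ρ ^ 4 * m.real (Metric.ball x ρ) := by
      rw [integral_indicator_const _ Metric.isOpen_ball.measurableSet, smul_eq_mul, mul_comm]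
    rw [← this]
    refine integral_mono ((integrable_indicator_iff Metric.isOpen_ball.measurableSet).2
      (integrableOn_const hfin.ne)) hint fun y => ?_
    by_cases hy : y ∈ Metric.ball x ρ
    · simp only [indicator_of_mem hy]
      rw [Metric.mem_ball, dist_eq_norm] at hy
      have h1 : ‖y - x‖ ^ 2 ≤ ρ ^ 2 := by gcongr
      have h2 : 3 * ρ ^ 2 ≤ max 0 (4 * ρ ^ 2 - ‖y - x‖ ^ 2) :=
        le_max_of_le_right (by linarith)
      calc 9 * ρ ^ 4 = (3 * ρ ^ 2) ^ 2 := by ring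
        _ ≤ _ := by rw [radialCutoff]; gcongr
    · simp only [indicator_of_notMem hy]
      exact radialCutoff_nonneg x ρ y
  have hexc := hex.integral_radialCutoff_mul_le hE hη hρ hρr
  have hI : 0 ≤ ∫ y, radialCutoff x ρ y ∂m := integral_nonneg (radialCutoff_nonneg x ρ)
  have hexc' : η * ∫ y, radialCutoff x ρ y ∂m ≤ 1 / 2 * ∫ y, radialCutoff x ρ y ∂m := by gcongr
  have hV : 0 ≤ volume.real (E ∩ Metric.ball x (2 * ρ)) := measureReal_nonneg
  -- Absorption yields 2 · 32 = 64, rounded up to 72 = 9 · 8.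
  have hfinal : 9 * ρ ^ 4 * m.real (Metric.ball x ρ) ≤
      9 * ρ ^ 4 * (8 / ρ * volume.real (E ∩ Metric.ball x (2 * ρ))) := by
    have h1 : 9 * ρ ^ 4 * (8 / ρ * volume.real (E ∩ Metric.ball x (2 * ρ))) =
      72 * (ρ ^ 3 * volume.real (E ∩ Metric.ball x (2 * ρ))) := by field_simp; ring
    have h2 : 0 ≤ ρ ^ 3 * volume.real (E ∩ Metric.ball x (2 * ρ)) := by positivity
    rw [h1]
    linarith
  exact le_of_mul_le_mul_left hfinal (by positivity)

/-! ### Almost monotonicity of E under inward translations. -/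

theorem measurable_indicator_one (hmeas : MeasurableSet E) :
    Measurable (E.indicator (fun _ => (1 : ℝ))) := measurable_const.indicator hmeas

theorem norm_indicator_one_mul_le (E : Set (Eucl n)) (y : Eucl n) (a : ℝ) :
    ‖E.indicator (fun _ => (1 : ℝ)) y * a‖ ≤ ‖a‖ := by
  by_cases hy : y ∈ E <;> simp [hy]

theorem integrable_indicator_one_mul (hmeas : MeasurableSet E) {f : Eucl n → ℝ}
    (hf : Integrable f) : Integrable (fun y => E.indicator (fun _ => (1 : ℝ)) y * f y) :=
  hf.mono ((measurable_indicator_one hmeas).aestronglyMeasurable.mul hf.aestronglyMeasurable)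
    (ae_of_all _ fun y => norm_indicator_one_mul_le E y (f y))

theorem hasDerivAt_integral_indicator_mul_translate (hmeas : MeasurableSet E) {φ : Eucl n → ℝ}
    (hφ : ContDiff ℝ 1 φ) (hc : HasCompactSupport φ) (h : Eucl n) (t₀ : ℝ) :
    HasDerivAt (fun t : ℝ => ∫ y, E.indicator (fun _ => (1 : ℝ)) y * φ (y - t • h))
      (∫ y, E.indicator (fun _ => (1 : ℝ)) y * fderiv ℝ φ (y - t₀ • h) (-h)) t₀ := by
  have hd : Continuous fun z => fderiv ℝ φ z (-h) :=
    (hφ.continuous_fderiv one_ne_zero).clm_apply continuous_const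
  obtain ⟨C, hC⟩ := (hc.fderiv_apply ℝ (-h)).exists_bound_of_continuous hd
  have hC0 : 0 ≤ C := (norm_nonneg _).trans (hC 0)
  obtain ⟨r, hr⟩ := hc.isCompact.isBounded.subset_closedBall (0 : Eucl n)
  -- This ball contains the supports of all translates with |t| ≤ |t₀| + 1, so it carries the
  -- dominating function.
  set B := Metric.closedBall (0 : Eucl n) (r + (|t₀| + 1) * ‖h‖) with hB
  have htr (t : ℝ) : Continuous fun y : Eucl n => y - t • h := by fun_prop
  refine (hasDerivAt_integral_of_dominated_loc_of_deriv_le (bound := B.indicator fun _ => C)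
    (F' := fun t y => E.indicator (fun _ => (1 : ℝ)) y * fderiv ℝ φ (y - t • h) (-h))
    (Metric.ball_mem_nhds t₀ one_pos) ?_ ?_ ?_ ?_ ?_ ?_).2
  · exact Eventually.of_forall fun t => ((measurable_indicator_one hmeas).mul
      (hφ.continuous.comp (htr t)).measurable).aestronglyMeasurable
  · exact integrable_indicator_one_mul hmeas
      ((hφ.continuous.integrable_of_hasCompactSupport hc).comp_sub_right (t₀ • h))
  · exact ((measurable_indicator_one hmeas).mul
      (hd.comp (htr t₀)).measurable).aestronglyMeasurable
  · refine ae_of_all _ fun y t ht => ?_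
    by_cases hy : y ∈ B
    · rw [indicator_of_mem hy]
      exact (norm_indicator_one_mul_le E y _).trans (hC _)
    · have hz : fderiv ℝ φ (y - t • h) = 0 := by
        refine fderiv_of_notMem_tsupport ℝ fun hmem => hy ?_
        have h1 := hr hmem
        rw [mem_closedBall_zero_iff] at h1 ⊢
        have h2 : |t| ≤ |t₀| + 1 := by
          rw [Metric.mem_ball, Real.dist_eq] at ht
          have := abs_sub_abs_le_abs_sub t t₀
          linarith
        calc ‖y‖ = ‖(y - t • h) + t • h‖ := by rw [sub_add_cancel]
          _ ≤ ‖y - t • h‖ + ‖t • h‖ := norm_add_le _ _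
          _ ≤ r + (|t₀| + 1) * ‖h‖ := by
            rw [norm_smul, Real.norm_eq_abs]; gcongr
      simp [hz, indicator_of_notMem hy]
  · exact (integrable_indicator_iff Metric.isClosed_closedBall.measurableSet).2
      (integrableOn_const (isCompact_closedBall _ _).measure_lt_top.ne)
  · refine ae_of_all _ fun y t _ => HasDerivAt.const_mul _ ?_
    have h1 : HasDerivAt (fun t : ℝ => y - t • h) (-h) t := by
      simpa using ((hasDerivAt_id t).smul_const h).const_sub y
    exact ((hφ.differentiable one_ne_zero _).hasFDerivAt).comp_hasDerivAt t h1

/-- Along the translations by t h the loss has derivative ∫ ψ (-h) · σ dm. Since h · ν ≤ 0,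
replacing σ by σ + ν only increases this, and the excess bounds the result. -/
theorem integral_indicator_sub_translate_le (hE : IsGradientMeasure E m σ)
    (hmeas : MeasurableSet E) {φ : Eucl n → ℝ} (hφ : ContDiff ℝ 1 φ)
    (h01 : ∀ y, φ y ∈ Icc (0 : ℝ) 1) {ρ : ℝ} (hz : ∀ y, y ∉ Metric.ball x ρ → φ y = 0)
    {h : Eucl n} (hh : inner ℝ h ν ≤ 0) :
    (∫ y, E.indicator (fun _ => (1 : ℝ)) y * φ y) -
      ∫ y, E.indicator (fun _ => (1 : ℝ)) y * φ (y - h) ≤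
      ‖h‖ * ∫ y in Metric.ball x (ρ + ‖h‖), ‖σ y + ν‖ ∂m := by
  have hc : HasCompactSupport φ := hasCompactSupport_of_eq_zero_off_ball hz
  set G : ℝ → ℝ := fun t => ∫ y, E.indicator (fun _ => (1 : ℝ)) y * φ (y - t • h) with hG
  have hder (t : ℝ) := hasDerivAt_integral_indicator_mul_translate hmeas hφ hc h t
  have hderiv (t : ℝ) (ht : t ∈ Ioo (0 : ℝ) 1) :
      deriv (-G) t ≤ ‖h‖ * ∫ y in Metric.ball x (ρ + ‖h‖), ‖σ y + ν‖ ∂m := by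
    rw [(hder t).neg.deriv]
    set ψ : Eucl n → ℝ := fun y => φ (y - t • h) with hψ
    have hψz (y) (hy : y ∉ Metric.ball x (ρ + ‖h‖)) : ψ y = 0 := by
      refine hz _ fun hmem => hy ?_
      rw [Metric.mem_ball, dist_eq_norm] at hmem ⊢
      calc ‖y - x‖ = ‖(y - t • h - x) + t • h‖ := by congr 1; abel
        _ ≤ ‖y - t • h - x‖ + ‖t • h‖ := norm_add_le _ _
        _ < ρ + ‖h‖ := by
          refine add_lt_add_of_lt_of_le hmem ?_
          rw [norm_smul, Real.norm_of_nonneg ht.1.le]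
          exact mul_le_of_le_one_left (norm_nonneg _) ht.2.le
    have hψd : ContDiff ℝ 1 ψ := hφ.comp (contDiff_id.sub contDiff_const)
    have hψf (y) : fderiv ℝ φ (y - t • h) = fderiv ℝ ψ y := (fderiv_comp_sub _).symm
    simp_rw [hψf]
    rw [hE.integral_fderiv_eq hψd (hasCompactSupport_of_eq_zero_off_ball hψz), neg_neg,
      ← integral_const_mul, ← setIntegral_eq_integral_of_forall_compl_eq_zero
        (s := Metric.ball x (ρ + ‖h‖)) fun y hy => by rw [hψz y hy, zero_mul]]
    have := hE.locallyFinite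
    have hfin : m (Metric.ball x (ρ + ‖h‖)) < ∞ := measure_ball_lt_top
    refine integral_mono_ae ?_ ((hE.integrableOn_ball_norm_add x ν _).const_mul _)
      (ae_of_all _ fun y => ?_)
    · refine Measure.integrableOn_of_bounded (M := ‖h‖) hfin.ne
        (hψd.continuous.measurable.mul
          (measurable_const.inner hE.measurable)).aestronglyMeasurable ?_
      filter_upwards [ae_restrict_of_ae hE.norm_eq_one] with y hy
      rw [norm_mul, Real.norm_of_nonneg (h01 _).1]
      calc φ (y - t • h) * ‖inner ℝ (-h) (σ y)‖ ≤ 1 * (‖-h‖ * ‖σ y‖) :=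
            mul_le_mul (h01 _).2 (norm_inner_le_norm _ _) (norm_nonneg _) zero_le_one
        _ = ‖h‖ := by rw [hy, norm_neg, one_mul, mul_one]
    · have h1 : inner ℝ (-h) (σ y) ≤ ‖h‖ * ‖σ y + ν‖ := by
        have := real_inner_le_norm (-h) (σ y + ν)
        rw [inner_add_right, norm_neg] at this
        rw [inner_neg_left (y := ν)] at this
        linarith
      calc ψ y * inner ℝ (-h) (σ y) ≤ ψ y * (‖h‖ * ‖σ y + ν‖) :=
            mul_le_mul_of_nonneg_left h1 (h01 _).1
        _ ≤ ‖h‖ * ‖σ y + ν‖ := mul_le_of_le_one_left (by positivity) (h01 _).2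
  have := (convex_Icc (0 : ℝ) 1).image_sub_le_mul_sub_of_deriv_le (f := -G)
    (fun t _ => (hder t).neg.continuousAt.continuousWithinAt)
    (fun t _ => (hder t).neg.differentiableAt.differentiableWithinAt)
    (fun t ht => hderiv t (by simpa using ht)) 0 (by simp) 1 (by simp) zero_le_one
  simp only [hG, Pi.neg_apply, one_smul, zero_smul, sub_zero, mul_one] at this
  linarith

open scoped Manifold ContDiff in
theorem exists_contDiff_support_eq_one_on {U K : Set (Eucl n)} (hU : IsOpen U) (hK : IsClosed K)
    (hKU : K ⊆ U) : ∃ φ : Eucl n → ℝ, ContDiff ℝ 1 φ ∧ (∀ y, φ y ∈ Icc (0 : ℝ) 1) ∧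
      (∀ y ∉ U, φ y = 0) ∧ ∀ y ∈ K, φ y = 1 := by
  obtain ⟨φ, h1, h2, h3, h4⟩ :=
    exists_contMDiff_support_eq_eq_one_iff (n := 1) 𝓘(ℝ, Eucl n) hU hK hKU
  refine ⟨φ, h1.contDiff, fun y => h2 (mem_range_self y), fun y hy => ?_, fun y hy => (h4 y).1 hy⟩
  rw [← h3] at hy
  exact Function.notMem_support.1 hy

/-- Where the excess is small, moving in an inward direction `h` rarely leads out of `E`. -/
theorem IsGradientMeasure.measureReal_exit_le (hE : IsGradientMeasure E m σ)
    (hmeas : MeasurableSet E) (x : Eucl n) (ρ : ℝ) {h : Eucl n} (hh : inner ℝ h ν ≤ 0) :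
    volume.real {y | (y ∈ E ∧ y ∈ Metric.ball x ρ) ∧ y + h ∉ E} ≤
      ‖h‖ * ∫ y in Metric.ball x (ρ + ‖h‖), ‖σ y + ν‖ ∂m := by
  set A : Set (Eucl n) := {y | (y ∈ E ∧ y ∈ Metric.ball x ρ) ∧ y + h ∉ E} with hA
  have hAm : MeasurableSet A :=
    (hmeas.inter Metric.isOpen_ball.measurableSet).inter
      ((measurable_id.add_const h) hmeas.compl)
  have hAfin : volume A ≠ ∞ :=
    ((measure_mono fun y hy => hy.1.2).trans_lt (measure_ball_lt_top (x := x) (r := ρ))).ne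
  refine le_of_forall_pos_le_add fun ε hε => ?_
  have hε2 : ENNReal.ofReal (ε / 2) ≠ 0 := by simpa using hε
  -- The cutoff φ approximates the indicator of A: it is 1 on a compact K inside A and 0 off a thin
  -- open neighbourhood V of K.
  obtain ⟨K, hKA, hK, hAK⟩ := hAm.exists_isCompact_lt_add hAfin hε2
  obtain ⟨U, hKU, hU, hUK⟩ := K.exists_isOpen_lt_add (μ := volume) hK.measure_lt_top.ne hε2
  set V := U ∩ Metric.ball x ρ with hV
  have hVfin : volume V ≠ ∞ :=
    ((measure_mono inter_subset_right).trans_lt (measure_ball_lt_top (x := x) (r := ρ))).ne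
  have hKV : K ⊆ V := fun y hy => ⟨hKU hy, (hKA hy).1.2⟩
  have hKfin : volume K ≠ ∞ := hK.measure_lt_top.ne
  obtain ⟨φ, hφ, h01, hφV, hφK⟩ :=
    exists_contDiff_support_eq_one_on (hU.inter Metric.isOpen_ball) hK.isClosed hKV
  have hz (y) (hy : y ∉ Metric.ball x ρ) : φ y = 0 := hφV y fun h => hy h.2
  have hmain := integral_indicator_sub_translate_le hE hmeas hφ h01 hz hh
  have hφint : Integrable φ :=
    hφ.continuous.integrable_of_hasCompactSupport (hasCompactSupport_of_eq_zero_off_ball hz)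
  have htr : ∫ y, E.indicator (fun _ => (1 : ℝ)) y * φ (y - h) =
      ∫ y, E.indicator (fun _ => (1 : ℝ)) (y + h) * φ y := by
    rw [← integral_add_right_eq_self _ h]
    simp
  have hshift : Integrable fun y => E.indicator (fun _ => (1 : ℝ)) (y + h) * φ y :=
    hφint.mono (((measurable_indicator_one hmeas).comp
      (measurable_id.add_const h)).aestronglyMeasurable.mul hφint.aestronglyMeasurable)
      (ae_of_all _ fun y => norm_indicator_one_mul_le _ _ _)
  have hdm : MeasurableSet (V \ K) := (hU.inter Metric.isOpen_ball).measurableSet.diff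
    hK.measurableSet
  have hdfin : volume (V \ K) ≠ ∞ := ((measure_mono sdiff_subset).trans_lt hVfin.lt_top).ne
  have hI1 : Integrable (K.indicator fun _ => (1 : ℝ)) :=
    (integrable_indicator_iff hK.measurableSet).2 (integrableOn_const hKfin)
  have hI2 : Integrable ((V \ K).indicator fun _ => (1 : ℝ)) :=
    (integrable_indicator_iff hdm).2 (integrableOn_const hdfin)
  have hlow : volume.real K - volume.real (V \ K) ≤
      (∫ y, E.indicator (fun _ => (1 : ℝ)) y * φ y) -
        ∫ y, E.indicator (fun _ => (1 : ℝ)) y * φ (y - h) := by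
    rw [htr, ← integral_sub (integrable_indicator_one_mul hmeas hφint) hshift]
    have : ∫ y, (K.indicator (fun _ => (1 : ℝ)) y - (V \ K).indicator (fun _ => (1 : ℝ)) y) =
        volume.real K - volume.real (V \ K) := by
      rw [integral_sub hI1 hI2, integral_indicator_const _ hK.measurableSet,
        integral_indicator_const _ hdm]
      simp
    rw [← this]
    -- On K the integrand is 1, on V \ K it is at least -1, and elsewhere it vanishes.
    refine integral_mono (hI1.sub hI2)
      ((integrable_indicator_one_mul hmeas hφint).sub hshift) fun y => ?_
    by_cases hyK : y ∈ K
    · have h1 : y ∈ E := (hKA hyK).1.1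
      have h2 : y + h ∉ E := (hKA hyK).2
      simp [hyK, h1, h2, hφK y hyK]
    · by_cases hyV : y ∈ V
      · have h1 : -1 ≤ -(E.indicator (fun _ => (1 : ℝ)) (y + h) * φ y) := by
          have := norm_indicator_one_mul_le E (y + h) (φ y)
          rw [Real.norm_of_nonneg (h01 y).1] at this
          linarith [Real.le_norm_self (E.indicator (fun _ => (1 : ℝ)) (y + h) * φ y), (h01 y).2]
        have h2 : 0 ≤ E.indicator (fun _ => (1 : ℝ)) y * φ y :=
          mul_nonneg (indicator_nonneg (fun _ _ => zero_le_one) _) (h01 y).1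
        simp only [indicator_of_notMem hyK, indicator_of_mem (show y ∈ V \ K from ⟨hyV, hyK⟩)]
        linarith
      · simp [hyK, hyV, hφV y hyV]
  have e1 : volume.real A < volume.real K + ε / 2 := by
    have := (ENNReal.toReal_lt_toReal hAfin (by finiteness)).2 hAK
    rwa [ENNReal.toReal_add hKfin ENNReal.ofReal_ne_top,
      ENNReal.toReal_ofReal (by positivity)] at this
  have e2 : volume.real (V \ K) ≤ ε / 2 := by
    have h1 : volume V < volume K + ENNReal.ofReal (ε / 2) :=
      (measure_mono inter_subset_left).trans_lt hUK
    have := (ENNReal.toReal_lt_toReal hVfin (by finiteness)).2 h1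
    rw [ENNReal.toReal_add hKfin ENNReal.ofReal_ne_top,
      ENNReal.toReal_ofReal (by positivity)] at this
    rw [measureReal_sdiff hKV hK.measurableSet hVfin]
    have : volume.real V < volume.real K + ε / 2 := this
    linarith
  linarith

/-- The ball of radius ρ about -ρν lies in the inward half-space and in the ball of radius 2ρ about
0, so one bound serves all its translations. -/
theorem HasExcessLE.volume_exit_le (hE : IsGradientMeasure E m σ) (hν : ‖ν‖ = 1)
    (hmeas : MeasurableSet E) {η r₁ ρ : ℝ} (hex : HasExcessLE m σ x ν η r₁) (hρ : 0 < ρ)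
    (hρr : 3 * ρ < r₁) {h : Eucl n} (hh : h ∈ Metric.ball (-(ρ • ν)) ρ) :
    volume {y | (y ∈ E ∧ y ∈ Metric.ball x ρ) ∧ y + h ∉ E} ≤
      ENNReal.ofReal (2 * ρ * (η * m.real (Metric.ball x (3 * ρ)))) := by
  have hfin : volume {y | (y ∈ E ∧ y ∈ Metric.ball x ρ) ∧ y + h ∉ E} ≠ ∞ :=
    ((measure_mono fun y hy => hy.1.2).trans_lt (measure_ball_lt_top (x := x) (r := ρ))).ne
  rw [Metric.mem_ball, dist_eq_norm, sub_neg_eq_add] at hh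
  have hinner : inner ℝ h ν ≤ 0 := by
    have h1 := (real_inner_le_norm (h + ρ • ν) ν)
    rw [inner_add_left, real_inner_smul_left, real_inner_self_eq_norm_sq, hν] at h1
    linarith
  have hnorm : ‖h‖ ≤ 2 * ρ := by
    calc ‖h‖ = ‖(h + ρ • ν) - ρ • ν‖ := by rw [add_sub_cancel_right]
      _ ≤ ‖h + ρ • ν‖ + ‖ρ • ν‖ := norm_sub_le _ _
      _ ≤ 2 * ρ := by rw [norm_smul, hν, Real.norm_of_nonneg hρ.le]; linarith
  rw [← ofReal_measureReal hfin]
  refine ENNReal.ofReal_le_ofReal ((hE.measureReal_exit_le hmeas x ρ hinner).trans ?_)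
  have h3 : ∫ y in Metric.ball x (ρ + ‖h‖), ‖σ y + ν‖ ∂m ≤
      ∫ y in Metric.ball x (3 * ρ), ‖σ y + ν‖ ∂m :=
    setIntegral_mono_set (hE.integrableOn_ball_norm_add x ν _)
      (ae_of_all _ fun y => norm_nonneg _)
      (Metric.ball_subset_ball (by linarith)).eventuallyLE
  have h4 := hex (3 * ρ) (by positivity) hρr
  have h5 : 0 ≤ ∫ y in Metric.ball x (ρ + ‖h‖), ‖σ y + ν‖ ∂m :=
    integral_nonneg fun y => norm_nonneg _
  exact mul_le_mul hnorm (h3.trans h4) h5 (by positivity)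

/-! ### Volume decay, lower density and the tangent half-space. -/

/-- Where the excess is small and `E` occupies at most a small portion of a ball, the volume
of `E` decays faster than that of the balls. -/
theorem HasExcessLE.volume_decay (hE : IsGradientMeasure E m σ) (hν : ‖ν‖ = 1)
    (hmeas : MeasurableSet E) {η r₁ ρ : ℝ} (hη : 0 ≤ η) (hη' : η ≤ 1 / 2)
    (hex : HasExcessLE m σ x ν η r₁) (hρ : 0 < ρ) (hρr : 8 * ρ < r₁)
    (hsmall : volume (E ∩ Metric.ball x (8 * ρ)) ≤ volume (Metric.ball (0 : Eucl n) ρ) / 2) :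
    volume.real (E ∩ Metric.ball x ρ) ≤ 11 * η * volume.real (E ∩ Metric.ball x (8 * ρ)) := by
  set S : Set (Eucl n) := Metric.ball (-(ρ • ν)) ρ with hS
  have hSv : volume S = volume (Metric.ball (0 : Eucl n) ρ) := by
    rw [hS, ← Measure.addHaar_ball_center (μ := volume) (-(ρ • ν)) ρ]
  have hSfin : volume S ≠ ∞ := measure_ball_lt_top.ne
  have hSpos : volume S ≠ 0 := (Metric.measure_ball_pos _ _ hρ).ne'
  set c : ℝ := 2 * ρ * (η * m.real (Metric.ball x (3 * ρ))) with hc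
  have hc0 : 0 ≤ c := by positivity
  set D := E ∩ Metric.ball x ρ with hD
  have hDm : MeasurableSet D := hmeas.inter Metric.isOpen_ball.measurableSet
  have hDfin : volume D ≠ ∞ :=
    ((measure_mono inter_subset_right).trans_lt (measure_ball_lt_top (x := x) (r := ρ))).ne
  -- T is measured in both orders. For fixed h its slice is small by the exit bound; for fixed y in
  -- D at least half of S leads out of E, because E fills at most half of y + S.
  set T : Set (Eucl n × Eucl n) :=
    {p | p.1 ∈ S ∧ (p.2 ∈ E ∧ p.2 ∈ Metric.ball x ρ) ∧ p.2 + p.1 ∉ E} with hT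
  have hTm : MeasurableSet T :=
    (measurable_fst Metric.isOpen_ball.measurableSet).inter
      ((measurable_snd hDm).inter ((measurable_snd.add measurable_fst) hmeas.compl))
  have hup : (volume.prod volume) T ≤ ENNReal.ofReal c * volume S := by
    rw [Measure.prod_apply hTm, ← setLIntegral_const, ← lintegral_indicator
      Metric.isOpen_ball.measurableSet]
    refine lintegral_mono fun h => ?_
    by_cases hh : h ∈ S
    · rw [indicator_of_mem hh]
      exact (measure_mono fun y hy => hy.2).trans
        (hex.volume_exit_le hE hν hmeas hρ (by linarith) hh)
    · rw [indicator_of_notMem hh]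
      have : Prod.mk h ⁻¹' T = ∅ := eq_empty_of_forall_notMem fun y hy => hh hy.1
      simp [this]
  have hlow : volume S / 2 * volume D ≤ (volume.prod volume) T := by
    rw [Measure.prod_apply_symm hTm, ← setLIntegral_const, ← lintegral_indicator hDm]
    refine lintegral_mono fun y => ?_
    by_cases hy : y ∈ D
    · rw [indicator_of_mem hy]
      have hin : volume {h | h ∈ S ∧ y + h ∈ E} ≤ volume S / 2 := by
        rw [hSv]
        refine le_trans ?_ hsmall
        rw [← measure_preimage_add volume y (E ∩ Metric.ball x (8 * ρ))]
        refine measure_mono fun h hh => ⟨hh.2, ?_⟩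
        have h1 := hh.1
        have h2 := hy.2
        rw [hS, Metric.mem_ball, dist_eq_norm, sub_neg_eq_add] at h1
        rw [Metric.mem_ball, dist_eq_norm] at h2 ⊢
        calc ‖y + h - x‖ = ‖(y - x) + ((h + ρ • ν) - ρ • ν)‖ := by congr 1; abel
          _ ≤ ‖y - x‖ + (‖h + ρ • ν‖ + ‖ρ • ν‖) :=
            (norm_add_le _ _).trans (by gcongr; exact norm_sub_le _ _)
          _ < 8 * ρ := by rw [norm_smul, hν, Real.norm_of_nonneg hρ.le]; linarith
      have hcov : volume S ≤ volume ((fun h => (h, y)) ⁻¹' T) + volume S / 2 := by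
        refine (measure_mono fun h hh => ?_).trans
          ((measure_union_le _ {h | h ∈ S ∧ y + h ∈ E}).trans (by gcongr))
        by_cases hyE : y + h ∈ E
        · exact Or.inr ⟨hh, hyE⟩
        · exact Or.inl ⟨hh, hy, hyE⟩
      rw [← ENNReal.sub_half hSfin]
      exact tsub_le_iff_right.2 hcov
    · rw [indicator_of_notMem hy]
      exact zero_le
  have hcomb : volume.real S / 2 * volume.real D ≤ c * volume.real S := by
    have := ENNReal.toReal_mono (by finiteness) (hlow.trans hup)
    rwa [ENNReal.toReal_mul, ENNReal.toReal_mul, ENNReal.toReal_div,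
      ENNReal.toReal_ofReal hc0] at this
  have hSr : 0 < volume.real S := ENNReal.toReal_pos hSpos hSfin
  have hDc : volume.real D ≤ 2 * c := by
    have : volume.real S * volume.real D ≤ volume.real S * (2 * c) := by linarith
    exact le_of_mul_le_mul_left this hSr
  have hper := hex.measureReal_ball_le hE hν hmeas hη hη' (show 0 < 3 * ρ by positivity)
    (by linarith)
  have hmono : volume.real (E ∩ Metric.ball x (2 * (3 * ρ))) ≤
      volume.real (E ∩ Metric.ball x (8 * ρ)) :=
    measureReal_mono (inter_subset_inter_right _ (Metric.ball_subset_ball (by linarith)))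
      ((measure_mono inter_subset_right).trans_lt measure_ball_lt_top).ne
  calc volume.real D ≤ 2 * c := hDc
    _ ≤ 2 * (2 * ρ * (η * (8 / (3 * ρ) * volume.real (E ∩ Metric.ball x (8 * ρ))))) := by
      rw [hc]; gcongr; exact hper.trans (by gcongr)
    _ = 32 / 3 * η * volume.real (E ∩ Metric.ball x (8 * ρ)) := by field_simp; ring
    _ ≤ _ := by gcongr; norm_num

theorem volumeReal_ball (x : Eucl n) {r : ℝ} (hr : 0 < r) :
    volume.real (Metric.ball x r) = volume.real (Metric.ball (0 : Eucl n) 1) * r ^ n := by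
  rw [Measure.real, Measure.addHaar_ball_of_pos _ _ hr, ENNReal.toReal_mul,
    ENNReal.toReal_ofReal (by positivity), finrank_euclideanSpace_fin, mul_comm]
  rfl

theorem volumeReal_ball_one_pos : 0 < volume.real (Metric.ball (0 : Eucl n) 1) :=
  ENNReal.toReal_pos (Metric.measure_ball_pos _ _ one_pos).ne' measure_ball_lt_top.ne

/-- Lower density estimate at a point of the reduced boundary. -/
theorem exists_le_volumeReal_inter_ball (hE : IsGradientMeasure E m σ) (hν : ‖ν‖ = 1)
    (hmeas : MeasurableSet E)
    (hlim : Tendsto (fun r : ℝ => (m.real (Metric.ball x r))⁻¹ •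
      ∫ y in Metric.ball x r, σ y ∂m) (𝓝[>] 0) (𝓝 (-ν)))
    (hx : x ∉ densityPoints E 0) :
    ∃ c > 0, ∃ r₁ > 0, ∀ r, 0 < r → r < r₁ → c * r ^ n ≤ volume.real (E ∩ Metric.ball x r) := by
  set ω := volume.real (Metric.ball (0 : Eucl n) 1) with hω
  have hω0 : 0 < ω := volumeReal_ball_one_pos
  have h8 : (1 : ℝ) ≤ 8 ^ n := one_le_pow₀ (by norm_num)
  -- With this η, 11 η 8ⁿ = 1/2, so each passage from radius 8ρ to ρ halves the density bound.
  set η : ℝ := 1 / (22 * 8 ^ n) with hη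
  have hη0 : 0 < η := by positivity
  have hη' : η ≤ 1 / 2 := by
    rw [hη]; exact one_div_le_one_div_of_le (by norm_num) (by linarith)
  obtain ⟨r₁, hr₁, hex⟩ := exists_hasExcessLE hE hν hlim hη0
  -- A volume at most c₀ (8ρ)ⁿ is exactly what the half-ball hypothesis of the decay lemma requires.
  set c₀ : ℝ := ω / (2 * 8 ^ n) with hc₀
  have hc₀pos : 0 < c₀ := by positivity
  refine ⟨c₀ / 8 ^ n, by positivity, r₁, hr₁, ?_⟩
  by_contra! hcon
  obtain ⟨ρ₀, hρ₀, hρ₀r, hsm⟩ := hcon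
  have hfin (r : ℝ) : volume (E ∩ Metric.ball x r) ≠ ∞ :=
    ((measure_mono inter_subset_right).trans_lt measure_ball_lt_top).ne
  -- The whole range of t is treated, so that every small radius is covered. In the base case
  -- monotonicity costs 8ⁿ, hence the contradiction starts from c₀ / 8ⁿ.
  have hdecay (k : ℕ) : ∀ t : ℝ, (1 / 8) ^ (k + 1) < t → t ≤ (1 / 8) ^ k →
      volume.real (E ∩ Metric.ball x (ρ₀ * t)) ≤ (1 / 2) ^ k * c₀ * (ρ₀ * t) ^ n := by
    induction k with
    | zero =>
      intro t ht ht'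
      have h1 : volume.real (E ∩ Metric.ball x (ρ₀ * t)) ≤ volume.real (E ∩ Metric.ball x ρ₀) :=
        measureReal_mono (inter_subset_inter_right _ (Metric.ball_subset_ball
          (mul_le_of_le_one_right hρ₀.le (by simpa using ht')))) (hfin _)
      have ht8 : ρ₀ ≤ 8 * (ρ₀ * t) := by
        have : 1 ≤ 8 * t := by norm_num at ht; linarith
        nlinarith
      calc volume.real (E ∩ Metric.ball x (ρ₀ * t)) ≤ c₀ / 8 ^ n * ρ₀ ^ n := h1.trans hsm.le
        _ ≤ c₀ / 8 ^ n * (8 * (ρ₀ * t)) ^ n := by gcongr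
        _ = (1 / 2) ^ 0 * c₀ * (ρ₀ * t) ^ n := by rw [mul_pow 8]; field_simp
    | succ k ih =>
      intro t ht ht'
      have ht0 : 0 < t := lt_trans (by positivity) ht
      have hρt : 0 < ρ₀ * t := by positivity
      have h1 := ih (8 * t) (by rw [pow_succ] at ht; linarith) (by rw [pow_succ] at ht'; linarith)
      have hk1 : ((1 : ℝ) / 8) ^ k ≤ 1 := pow_le_one₀ (by norm_num) (by norm_num)
      have hk2 : ((1 : ℝ) / 2) ^ k ≤ 1 := pow_le_one₀ (by norm_num) (by norm_num)
      rw [show ρ₀ * (8 * t) = 8 * (ρ₀ * t) by ring] at h1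
      have h8t : 8 * (ρ₀ * t) < r₁ := by
        rw [pow_succ] at ht'
        have : 8 * t ≤ 1 := by linarith
        nlinarith
      have h2 : volume (E ∩ Metric.ball x (8 * (ρ₀ * t))) ≤
          volume (Metric.ball (0 : Eucl n) (ρ₀ * t)) / 2 := by
        rw [← ENNReal.toReal_le_toReal (hfin _)
          (ENNReal.div_ne_top measure_ball_lt_top.ne (by norm_num)), ENNReal.toReal_div]
        refine h1.trans ?_
        change _ ≤ volume.real _ / 2
        rw [volumeReal_ball _ hρt, ← hω]
        calc (1 / 2) ^ k * c₀ * (8 * (ρ₀ * t)) ^ n ≤ 1 * c₀ * (8 * (ρ₀ * t)) ^ n := by gcongr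
          _ = ω * (ρ₀ * t) ^ n / 2 := by rw [hc₀, mul_pow 8]; field_simp
      have h3 := hex.volume_decay hE hν hmeas hη0.le hη' hρt h8t h2
      calc volume.real (E ∩ Metric.ball x (ρ₀ * t))
          ≤ 11 * η * ((1 / 2) ^ k * c₀ * (8 * (ρ₀ * t)) ^ n) := h3.trans (by gcongr)
        _ = (1 / 2) ^ (k + 1) * c₀ * (ρ₀ * t) ^ n := by
          rw [hη, mul_pow 8, pow_succ]; field_simp; ring
  apply hx
  rw [densityPoints, mem_ofPred_eq, Metric.tendsto_nhds]
  intro ε hε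
  obtain ⟨N, hN⟩ := exists_pow_lt_of_lt_one hε (show (1 / 2 : ℝ) < 1 by norm_num)
  filter_upwards [Ioo_mem_nhdsGT (show 0 < ρ₀ * (1 / 8) ^ N by positivity)] with r hr
  have hr0 : 0 < r := hr.1
  have hrN : r / ρ₀ < (1 / 8) ^ N := by
    rw [div_lt_iff₀ hρ₀]; linarith [hr.2]
  have hr1 : r / ρ₀ ≤ 1 := hrN.le.trans (pow_le_one₀ (by norm_num) (by norm_num))
  obtain ⟨k, hk, hk'⟩ := exists_nat_pow_near_of_lt_one (show 0 < r / ρ₀ by positivity) hr1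
    (show (0 : ℝ) < 1 / 8 by norm_num) (by norm_num)
  have hNk : N ≤ k := by
    have := (pow_lt_pow_iff_right_of_lt_one₀ (show (0 : ℝ) < 1 / 8 by norm_num)
      (by norm_num)).1 (hk.trans hrN)
    omega
  have hfinal := hdecay k _ hk hk'
  rw [mul_div_cancel₀ r hρ₀.ne'] at hfinal
  rw [Real.dist_eq, sub_zero, abs_of_nonneg (by positivity), ← hω,
    div_lt_iff₀ (by positivity)]
  have hpow : ((1 : ℝ) / 2) ^ k ≤ (1 / 2) ^ N :=
    pow_le_pow_of_le_one (by norm_num) (by norm_num) hNk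
  have hcω : c₀ ≤ ω := div_le_self hω0.le (by linarith)
  calc volume.real (E ∩ Metric.ball x r) ≤ (1 / 2) ^ k * c₀ * r ^ n := hfinal
    _ ≤ (1 / 2) ^ N * ω * r ^ n := by gcongr
    _ < ε * ω * r ^ n := by gcongr
    _ = _ := by ring

/-- At small scales `E` meets every ball centred in the closure of the tangent half-space. -/
theorem eventually_ball_inter_nonempty (hE : IsGradientMeasure E m σ) (hν : ‖ν‖ = 1)
    (hmeas : MeasurableSet E)
    (hlim : Tendsto (fun r : ℝ => (m.real (Metric.ball x r))⁻¹ •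
      ∫ y in Metric.ball x r, σ y ∂m) (𝓝[>] 0) (𝓝 (-ν)))
    (hx : x ∉ densityPoints E 0) {p : Eucl n} (hp : inner ℝ p ν ≤ 0) {s : ℝ} (hs : 0 < s) :
    ∀ᶠ r : ℝ in 𝓝[>] 0, (E ∩ Metric.ball (x + r • p) (r * s)).Nonempty := by
  obtain ⟨c, hc, r₁, hr₁, hlow⟩ := exists_le_volumeReal_inter_ball hE hν hmeas hlim hx
  set ω := volume.real (Metric.ball (0 : Eucl n) 1) with hω
  have hω0 : 0 < ω := volumeReal_ball_one_pos
  set q := s + ‖p‖ with hq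
  have hq0 : 0 < q := by positivity
  -- The second term makes the exit bound at most half the lower bound c (r s)ⁿ on the volume near
  -- x.
  set η : ℝ := min (1 / 2) (c * s ^ n / (16 * ω * (2 * q) ^ n)) with hη
  have hη0 : 0 < η := lt_min (by norm_num) (by positivity)
  obtain ⟨r₂, hr₂, hex⟩ := exists_hasExcessLE hE hν hlim hη0
  filter_upwards [Ioo_mem_nhdsGT (show 0 < min (r₁ / s) (r₂ / (2 * q)) by positivity)] with r hr
  have hr0 : 0 < r := hr.1
  have hr1 : r * s < r₁ := by
    rw [← lt_div_iff₀ hs]; exact hr.2.trans_le (min_le_left _ _)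
  have hr2 : 2 * (r * q) < r₂ := by
    have : r * (2 * q) < r₂ := by
      rw [← lt_div_iff₀ (by positivity)]; exact hr.2.trans_le (min_le_right _ _)
    linarith
  by_contra hemp
  rw [not_nonempty_iff_eq_empty] at hemp
  have hinner : inner ℝ (r • p) ν ≤ 0 := by
    rw [real_inner_smul_left]; exact mul_nonpos_of_nonneg_of_nonpos hr0.le hp
  have hexit := hE.measureReal_exit_le hmeas x (r * s) hinner
  -- If the target ball misses E, every point of E near x leaves E under translation by r p.
  have hset : {y | (y ∈ E ∧ y ∈ Metric.ball x (r * s)) ∧ y + r • p ∉ E} =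
      E ∩ Metric.ball x (r * s) := by
    refine Subset.antisymm (fun y hy => hy.1) fun y hy => ⟨hy, fun hyE => ?_⟩
    have : y + r • p ∈ E ∩ Metric.ball (x + r • p) (r * s) := by
      refine ⟨hyE, ?_⟩
      have h2 := hy.2
      rw [Metric.mem_ball, dist_eq_norm] at h2 ⊢
      rwa [add_sub_add_right_eq_sub]
    rw [hemp] at this
    exact this
  rw [hset, norm_smul, Real.norm_of_nonneg hr0.le, ← mul_add, ← hq] at hexit
  have h1 := hlow (r * s) (by positivity) hr1
  have h2 := hex (r * q) (by positivity) (by nlinarith [mul_pos hr0 hq0])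
  have h3 := hex.measureReal_ball_le hE hν hmeas hη0.le (min_le_left _ _)
    (show 0 < r * q by positivity) hr2
  have h4 : volume.real (E ∩ Metric.ball x (2 * (r * q))) ≤ ω * (2 * (r * q)) ^ n := by
    rw [hω, ← volumeReal_ball x (by positivity)]
    exact measureReal_mono inter_subset_right measure_ball_lt_top.ne
  have hpq : ‖p‖ ≤ q := by linarith
  have h5 : c * (r * s) ^ n ≤ r * q * (η * (8 / (r * q) * (ω * (2 * (r * q)) ^ n))) := by
    refine h1.trans (hexit.trans ?_)
    have h6 : ∫ y in Metric.ball x (r * q), ‖σ y + ν‖ ∂m ≤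
        η * (8 / (r * q) * (ω * (2 * (r * q)) ^ n)) :=
      h2.trans (by gcongr; exact h3.trans (by gcongr))
    have h7 : 0 ≤ ∫ y in Metric.ball x (r * q), ‖σ y + ν‖ ∂m :=
      integral_nonneg fun y => norm_nonneg _
    exact mul_le_mul (by gcongr) h6 h7 (by positivity)
  have h8 : r * q * (η * (8 / (r * q) * (ω * (2 * (r * q)) ^ n))) =
      η * (8 * ω * (2 * q) ^ n) * r ^ n := by
    rw [show 2 * (r * q) = 2 * q * r by ring, mul_pow (2 * q)]; field_simp
  have h9 : η * (8 * ω * (2 * q) ^ n) ≤ c * s ^ n / 2 := by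
    calc η * (8 * ω * (2 * q) ^ n)
        ≤ c * s ^ n / (16 * ω * (2 * q) ^ n) * (8 * ω * (2 * q) ^ n) := by
          gcongr; exact min_le_right _ _
      _ = c * s ^ n / 2 := by field_simp; norm_num
  rw [h8, mul_pow] at h5
  have h10 : 0 < c * s ^ n * r ^ n := by positivity
  have h11 := mul_le_mul_of_nonneg_right h9 (pow_nonneg hr0.le n)
  linarith

/-! ### Passage to the complement. -/

theorem integral_divergence_eq_zero {g : Eucl n → Eucl n} (hg : IsTestField univ g) :
    ∫ y, divergence g y = 0 := by
  have hdiff : Differentiable ℝ g := hg.contDiff.differentiable one_ne_zero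
  have hcomp (i : Fin n) : ContDiff ℝ 1 fun y => g y i :=
    (EuclideanSpace.proj (𝕜 := ℝ) i).contDiff.comp hg.contDiff
  have hcs (i : Fin n) : HasCompactSupport fun y => g y i :=
    hg.compact.comp_left (g := fun v : Eucl n => v i) rfl
  have hder (i : Fin n) (y : Eucl n) : (fderiv ℝ g y (EuclideanSpace.single i 1)) i =
      fderiv ℝ (fun z => g z i) y (EuclideanSpace.single i 1) := by
    have := ((EuclideanSpace.proj (𝕜 := ℝ) i : Eucl n →L[ℝ] ℝ).hasFDerivAt.comp y
      (hdiff y).hasFDerivAt)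
    have h2 : HasFDerivAt (fun z => g z i) _ y := this
    rw [h2.fderiv]; rfl
  have hint (i : Fin n) :
      Integrable fun y => fderiv ℝ (fun z => g z i) y (EuclideanSpace.single i 1) :=
    (((hcomp i).continuous_fderiv one_ne_zero).clm_apply
      continuous_const).integrable_of_hasCompactSupport ((hcs i).fderiv_apply ℝ _)
  unfold divergence
  simp_rw [hder]
  rw [integral_finsetSum _ fun i _ => hint i]
  refine Finset.sum_eq_zero fun i _ => ?_
  have := integral_mul_fderiv_eq_neg_fderiv_mul_of_integrable (μ := (volume : Measure (Eucl n)))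
    (f := fun _ => (1 : ℝ)) (g := fun z => g z i) (v := EuclideanSpace.single i 1)
    (by simp) (by simpa using hint i)
    (by simpa using (hcomp i).continuous.integrable_of_hasCompactSupport (hcs i))
    (fun y _ => differentiableAt_const _) (fun y _ => (hcomp i).differentiable one_ne_zero y)
  simpa using this

theorem IsTestField.integrable_divergence {g : Eucl n → Eucl n} (hg : IsTestField univ g) :
    Integrable (divergence g) := by
  refine integrable_finsetSum _ fun i _ => ?_
  have hcont : Continuous fun y => fderiv ℝ g y (EuclideanSpace.single i 1) :=
    (hg.contDiff.continuous_fderiv one_ne_zero).clm_apply continuous_const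
  exact ((EuclideanSpace.proj (𝕜 := ℝ) i : Eucl n →L[ℝ] ℝ).continuous.comp
    hcont).integrable_of_hasCompactSupport
      ((hg.compact.fderiv_apply ℝ _).comp_left (g := fun v : Eucl n => v i) rfl)

/-- Divergences of test fields integrate to zero, so replacing E by its complement only changes the
sign of σ. -/
theorem IsGradientMeasure.compl (hE : IsGradientMeasure E m σ) (hmeas : MeasurableSet E) :
    IsGradientMeasure Eᶜ m (-σ) where
  locallyFinite := hE.locallyFinite
  measurable := hE.measurable.neg
  norm_eq_one := by
    filter_upwards [hE.norm_eq_one] with y hy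
    rw [Pi.neg_apply, norm_neg, hy]
  integral_eq g hg := by
    have h1 : ∀ y, Eᶜ.indicator (fun _ => (1 : ℝ)) y * divergence g y =
        divergence g y - E.indicator (fun _ => (1 : ℝ)) y * divergence g y := by
      intro y
      by_cases hy : y ∈ E <;> simp [hy]
    simp_rw [h1]
    rw [integral_sub hg.integrable_divergence
      (integrable_indicator_one_mul hmeas hg.integrable_divergence),
      integral_divergence_eq_zero hg, hE.integral_eq g hg]
    simp [inner_neg_right, integral_neg]

theorem notMem_densityPoints_compl (hmeas : MeasurableSet E) (hx : x ∉ densityPoints E 1) :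
    x ∉ densityPoints Eᶜ 0 := by
  refine fun h => hx ?_
  rw [densityPoints, mem_ofPred_eq] at h ⊢
  have h' := h.const_sub 1
  rw [sub_zero] at h'
  refine h'.congr' ?_
  filter_upwards [self_mem_nhdsWithin] with r hr
  have hr0 : (0 : ℝ) < r := hr
  have hω0 : 0 < volume.real (Metric.ball (0 : Eucl n) 1) := volumeReal_ball_one_pos
  have hsum : volume.real (E ∩ Metric.ball x r) + volume.real (Eᶜ ∩ Metric.ball x r) =
      volume.real (Metric.ball (0 : Eucl n) 1) * r ^ n := by
    rw [← volumeReal_ball x hr0, inter_comm E, inter_comm Eᶜ]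
    have := measureReal_inter_add_sdiff (μ := volume) (s := Metric.ball x r) hmeas
      measure_ball_lt_top.ne
    rwa [sdiff_eq] at this
  rw [sub_eq_iff_eq_add, ← add_div, hsum, div_self (by positivity)]

/-! ### Signed distances and rescaling. -/

theorem signedDistFun_halfSpace (hν : ‖ν‖ = 1) {y : Eucl n} (hy : y ∈ halfSpace ν) :
    signedDistFun (halfSpace ν) y = inner ℝ y ν := by
  have hy' : inner ℝ y ν < 0 := hy
  -- The orthogonal projection of y onto the bounding hyperplane realises the distance to the
  -- complement.
  have hp : y - (inner ℝ y ν : ℝ) • ν ∈ (halfSpace ν)ᶜ := by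
    simp [halfSpace, inner_sub_left, real_inner_smul_left, hν]
  have h2 : Metric.infDist y (halfSpace ν)ᶜ = -inner ℝ y ν := by
    refine le_antisymm ((Metric.infDist_le_dist_of_mem hp).trans_eq ?_)
      ((Metric.le_infDist ⟨_, hp⟩).2 fun z hz => ?_)
    · rw [dist_eq_norm, sub_sub_cancel, norm_smul, hν, mul_one, Real.norm_of_nonpos hy'.le]
    · have hz' : 0 ≤ inner ℝ z ν := not_lt.1 hz
      have := real_inner_le_norm (z - y) ν
      rw [inner_sub_left, hν, mul_one, ← dist_eq_norm, dist_comm] at this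
      linarith
  rw [signedDistFun, Metric.infDist_zero_of_mem hy, h2]
  ring

theorem signedDistFun_eq_zero_of_mem_frontier {A : Set (Eucl n)} {y : Eucl n}
    (hy : y ∈ frontier A) : signedDistFun A y = 0 := by
  rw [frontier_eq_closure_inter_closure] at hy
  rw [signedDistFun, Metric.infDist_zero_of_mem_closure hy.1,
    Metric.infDist_zero_of_mem_closure hy.2, sub_zero]

theorem abs_signedDistFun_sub_le (A : Set (Eucl n)) (y z : Eucl n) :
    |signedDistFun A y - signedDistFun A z| ≤ 2 * dist y z := by
  have h (B : Set (Eucl n)) : |Metric.infDist y B - Metric.infDist z B| ≤ dist y z := by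
    have := (Metric.lipschitz_infDist_pt B).dist_le_mul y z
    simpa [Real.dist_eq] using this
  have h1 := abs_le.1 (h A)
  have h2 := abs_le.1 (h Aᶜ)
  rw [signedDistFun, signedDistFun, abs_le]
  constructor <;> linarith [h1.1, h1.2, h2.1, h2.2]

theorem rescale_eq_preimage (E : Set (Eucl n)) (x : Eucl n) {r : ℝ} (hr : r ≠ 0) :
    rescale E x r = (fun w => x + r • w) ⁻¹' E := by
  ext w
  constructor
  · rintro ⟨y, hy, rfl⟩
    simpa [smul_smul, hr] using hy
  · intro hw
    exact ⟨_, hw, by simp [smul_smul, hr]⟩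

theorem isOpen_rescale (hE : IsOpen E) (x : Eucl n) {r : ℝ} (hr : r ≠ 0) :
    IsOpen (rescale E x r) := by
  rw [rescale_eq_preimage E x hr]
  exact hE.preimage (by fun_prop)

theorem compl_rescale (E : Set (Eucl n)) (x : Eucl n) {r : ℝ} (hr : r ≠ 0) :
    (rescale E x r)ᶜ = rescale Eᶜ x r := by
  rw [rescale_eq_preimage E x hr, rescale_eq_preimage Eᶜ x hr, preimage_compl]

theorem rescale_inter_ball_nonempty {p : Eucl n} {r s : ℝ} (hr : 0 < r)
    (h : (E ∩ Metric.ball (x + r • p) (r * s)).Nonempty) :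
    (rescale E x r ∩ Metric.ball p s).Nonempty := by
  obtain ⟨y, hyE, hy⟩ := h
  refine ⟨r⁻¹ • (y - x), ⟨y, hyE, rfl⟩, ?_⟩
  rw [Metric.mem_ball, dist_eq_norm] at hy ⊢
  have h1 : r⁻¹ • (y - x) - p = r⁻¹ • (y - (x + r • p)) := by
    rw [← sub_sub, smul_sub r⁻¹ (y - x), smul_smul, inv_mul_cancel₀ hr.ne', one_smul]
  rw [h1, norm_smul, norm_inv, Real.norm_of_nonneg hr.le, inv_mul_lt_iff₀ hr]
  exact hy

theorem smul_mem_frontier_rescale {r s : ℝ} (hr : r ≠ 0) (hs : s ≠ 0) {y : Eucl n}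
    (hy : y ∈ frontier (rescale E x r)) : s⁻¹ • y ∈ frontier (rescale E x (r * s)) := by
  have h1 : rescale E x (r * s) = (Homeomorph.smulOfNeZero s hs) ⁻¹' (rescale E x r) := by
    rw [rescale_eq_preimage E x hr, rescale_eq_preimage E x (mul_ne_zero hr hs)]
    ext w
    simp [smul_smul]
  rw [h1, ← Homeomorph.preimage_frontier]
  simpa [smul_smul, hs] using hy

/-! ### The two implications. -/

/-- Locally uniform convergence of the signed distance functions forces the boundary points in
the half-space to be tangential. -/
theorem frontier_subset_cone_of_tendstoLocallyUniformlyOn (hν : ‖ν‖ = 1)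
    (hconv : TendstoLocallyUniformlyOn (fun r : ℝ => signedDistFun (rescale E x r))
      (signedDistFun (halfSpace ν)) (𝓝[>] 0) (halfSpace ν)) {ε R : ℝ} (hε : 0 < ε) (hR : 0 < R) :
    ∃ r₀ > (0 : ℝ), ∀ r : ℝ, 0 < r → r < r₀ →
      ∀ y ∈ frontier (rescale E x r) ∩ halfSpace ν, ‖y‖ ≤ R →
        -signedDistFun (halfSpace ν) y ≤ ε * ‖y‖ := by
  have hopen : IsOpen (halfSpace ν) :=
    isOpen_lt (continuous_id.inner continuous_const) continuous_const
  set K : Set (Eucl n) := Metric.sphere 0 1 ∩ {z | inner ℝ z ν ≤ -ε} with hK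
  have hKc : IsCompact K := (isCompact_sphere _ _).inter_right
    (isClosed_le (continuous_id.inner continuous_const) continuous_const)
  have hKH : K ⊆ halfSpace ν := fun z hz => by
    have h1 : inner ℝ z ν ≤ -ε := hz.2
    exact h1.trans_lt (by linarith)
  have hunif := (tendstoLocallyUniformlyOn_iff_forall_isCompact hopen).1 hconv K hKH hKc
  rw [Metric.tendstoUniformlyOn_iff] at hunif
  obtain ⟨δ, hδ, H⟩ := mem_nhdsGT_iff_exists_Ioo_subset.1 (hunif ε hε)
  have hδ' : (0 : ℝ) < δ := hδ
  -- The comparison takes place at scale r |y|, which is below δ when |y| ≤ R.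
  refine ⟨δ / R, by positivity, fun r hr hrδ y hy hyR => ?_⟩
  rw [signedDistFun_halfSpace hν hy.2]
  by_contra! hlt
  have hyH : inner ℝ y ν < 0 := hy.2
  have hy0 : 0 < ‖y‖ := norm_pos_iff.2 fun h => by simp [h] at hyH
  have hrs : r * ‖y‖ < δ := by
    rw [lt_div_iff₀ hR] at hrδ
    exact (mul_le_mul_of_nonneg_left hyR hr.le).trans_lt hrδ
  have hz : inner ℝ (‖y‖⁻¹ • y) ν < -ε := by
    rw [real_inner_smul_left, inv_mul_lt_iff₀ hy0]; linarith
  have hzK : ‖y‖⁻¹ • y ∈ K := by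
    refine ⟨?_, hz.le⟩
    rw [mem_sphere_zero_iff_norm, norm_smul, norm_inv, norm_norm, inv_mul_cancel₀ hy0.ne']
  have hd : dist (signedDistFun (halfSpace ν) (‖y‖⁻¹ • y))
      (signedDistFun (rescale E x (r * ‖y‖)) (‖y‖⁻¹ • y)) < ε :=
    H (show r * ‖y‖ ∈ Ioo 0 δ from ⟨by positivity, hrs⟩) _ hzK
  rw [signedDistFun_halfSpace hν (hKH hzK), signedDistFun_eq_zero_of_mem_frontier
    (smul_mem_frontier_rescale hr.ne' hy0.ne' hy.1), Real.dist_eq, sub_zero] at hd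
  linarith [neg_abs_le (inner ℝ (‖y‖⁻¹ • y) ν)]

/-- The ball about z of radius s - ε stays at depth more than ε, where the cone condition excludes
boundary points. Being connected and meeting the open set A, it lies in A. A complement point near
the projection z + sν gives the opposite bound. -/
theorem eventually_abs_signedDistFun_sub_le (hν : ‖ν‖ = 1) (hEo : IsOpen E)
    (hin : ∀ p : Eucl n, inner ℝ p ν ≤ 0 → ∀ s > 0, ∀ᶠ r : ℝ in 𝓝[>] 0,
      (E ∩ Metric.ball (x + r • p) (r * s)).Nonempty)
    (hout : ∀ p : Eucl n, 0 ≤ inner ℝ p ν → ∀ s > 0, ∀ᶠ r : ℝ in 𝓝[>] 0,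
      (Eᶜ ∩ Metric.ball (x + r • p) (r * s)).Nonempty)
    (hcone : ∀ ε > (0 : ℝ), ∀ R > (0 : ℝ), ∃ r₀ > (0 : ℝ), ∀ r : ℝ, 0 < r → r < r₀ →
      ∀ y ∈ frontier (rescale E x r) ∩ halfSpace ν, ‖y‖ ≤ R →
        -signedDistFun (halfSpace ν) y ≤ ε * ‖y‖)
    {z : Eucl n} {ε : ℝ} (hε : 0 < ε) (hεz : ε < -inner ℝ z ν) :
    ∀ᶠ r : ℝ in 𝓝[>] 0, |signedDistFun (rescale E x r) z - inner ℝ z ν| ≤ ε := by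
  set s : ℝ := -inner ℝ z ν with hs
  have hs0 : 0 < s := hε.trans hεz
  have hνν : inner ℝ ν ν = (1 : ℝ) := by rw [real_inner_self_eq_norm_sq, hν]; norm_num
  have hR : 0 < ‖z‖ + s := by positivity
  -- The aperture is chosen so that boundary points in `halfSpace ν` of norm at most |z| + s have
  -- depth at most ε.
  obtain ⟨r₀, hr₀, hfr⟩ := hcone (ε / (‖z‖ + s)) (by positivity) (‖z‖ + s) hR
  have hproj : 0 ≤ inner ℝ (z + s • ν) ν := by
    rw [inner_add_left, real_inner_smul_left, hνν]; linarith
  filter_upwards [Ioo_mem_nhdsGT hr₀, hin z (by linarith) (s - ε) (by linarith),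
    hout (z + s • ν) hproj ε hε] with r hr hr1 hr2
  have hne : r ≠ 0 := hr.1.ne'
  have hmeet := rescale_inter_ball_nonempty hr.1 hr1
  have hmeet' := rescale_inter_ball_nonempty hr.1 hr2
  rw [← compl_rescale E x hne] at hmeet'
  set A := rescale E x r with hA
  have hsub : Metric.ball z (s - ε) ⊆ A := by
    refine IsPreconnected.subset_left_of_subset_union (isOpen_rescale hEo x hne)
      isClosed_closure.isOpen_compl (disjoint_compl_right.mono_left subset_closure) ?_
      (by rwa [inter_comm]) (convex_ball z (s - ε)).isPreconnected
    intro y hy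
    by_contra hcon
    rw [mem_union, not_or, notMem_compl_iff] at hcon
    have hyfr : y ∈ frontier A := by
      rw [(isOpen_rescale hEo x hne).frontier_eq]
      exact ⟨hcon.2, hcon.1⟩
    rw [Metric.mem_ball, dist_eq_norm] at hy
    have hyν : inner ℝ y ν < -ε := by
      have := real_inner_le_norm (y - z) ν
      rw [inner_sub_left, hν, mul_one] at this
      linarith
    have hyH : y ∈ halfSpace ν := show inner ℝ y ν < 0 by linarith
    have hyR : ‖y‖ ≤ ‖z‖ + s := by
      calc ‖y‖ = ‖z + (y - z)‖ := by rw [add_sub_cancel]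
        _ ≤ ‖z‖ + ‖y - z‖ := norm_add_le _ _
        _ ≤ ‖z‖ + s := by linarith
    have h1 := hfr r hr.1 hr.2 y ⟨hyfr, hyH⟩ hyR
    rw [signedDistFun_halfSpace hν hyH] at h1
    have h2 : ε / (‖z‖ + s) * ‖y‖ ≤ ε := by
      calc ε / (‖z‖ + s) * ‖y‖ ≤ ε / (‖z‖ + s) * (‖z‖ + s) := by gcongr
        _ = ε := by field_simp
    linarith
  have hzA : z ∈ A := hsub (Metric.mem_ball_self (by linarith))
  obtain ⟨w, hwA, hw⟩ := hmeet'
  have hlow : s - ε ≤ Metric.infDist z Aᶜ := by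
    refine (Metric.le_infDist ⟨w, hwA⟩).2 fun y hy => ?_
    by_contra! hlt
    exact hy (hsub (by rwa [Metric.mem_ball, dist_comm]))
  have hup : Metric.infDist z Aᶜ ≤ s + ε := by
    refine (Metric.infDist_le_dist_of_mem hwA).trans ?_
    have h1 : dist z (z + s • ν) = s := by
      rw [dist_self_add_right, norm_smul, hν, mul_one, Real.norm_of_nonneg hs0.le]
    have h2 := dist_triangle z (z + s • ν) w
    rw [Metric.mem_ball, dist_comm] at hw
    linarith
  rw [signedDistFun, Metric.infDist_zero_of_mem hzA, abs_le]
  constructor <;> linarith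

/-- Signed distances are 2-Lipschitz uniformly in r, so the estimate at the centre z extends to a
small ball. -/
theorem tendstoLocallyUniformlyOn_signedDistFun (hν : ‖ν‖ = 1) (hEo : IsOpen E)
    (hin : ∀ p : Eucl n, inner ℝ p ν ≤ 0 → ∀ s > 0, ∀ᶠ r : ℝ in 𝓝[>] 0,
      (E ∩ Metric.ball (x + r • p) (r * s)).Nonempty)
    (hout : ∀ p : Eucl n, 0 ≤ inner ℝ p ν → ∀ s > 0, ∀ᶠ r : ℝ in 𝓝[>] 0,
      (Eᶜ ∩ Metric.ball (x + r • p) (r * s)).Nonempty)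
    (hcone : ∀ ε > (0 : ℝ), ∀ R > (0 : ℝ), ∃ r₀ > (0 : ℝ), ∀ r : ℝ, 0 < r → r < r₀ →
      ∀ y ∈ frontier (rescale E x r) ∩ halfSpace ν, ‖y‖ ≤ R →
        -signedDistFun (halfSpace ν) y ≤ ε * ‖y‖) :
    TendstoLocallyUniformlyOn (fun r : ℝ => signedDistFun (rescale E x r))
      (signedDistFun (halfSpace ν)) (𝓝[>] 0) (halfSpace ν) := by
  rw [Metric.tendstoLocallyUniformlyOn_iff]
  intro ε hε z hz
  have hz0 : 0 < -inner ℝ z ν := neg_pos.2 hz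
  set δ : ℝ := min (ε / 2) (-inner ℝ z ν / 2) with hδ
  have hδ0 : 0 < δ := by positivity
  refine ⟨Metric.ball z (ε / 8),
    mem_nhdsWithin_of_mem_nhds (Metric.ball_mem_nhds _ (by positivity)), ?_⟩
  filter_upwards [eventually_abs_signedDistFun_sub_le hν hEo hin hout hcone (z := z) hδ0
    ((min_le_right _ _).trans_lt (by linarith))] with r hr y hy
  rw [Metric.mem_ball] at hy
  have h1 := abs_le.1 (abs_signedDistFun_sub_le (halfSpace ν) y z)
  have h2 := abs_le.1 (abs_signedDistFun_sub_le (rescale E x r) y z)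
  have h3 := abs_le.1 hr
  have h4 : δ ≤ ε / 2 := min_le_left _ _
  rw [signedDistFun_halfSpace hν hz] at h1
  rw [Real.dist_eq, abs_lt]
  constructor <;> linarith [h1.1, h1.2, h2.1, h2.2, h3.1, h3.2]

theorem isOuterNormal_outerNormal (h : ∃ ν, IsOuterNormal E x ν) :
    IsOuterNormal E x (outerNormal E x) := by
  rw [outerNormal, dif_pos h]
  exact h.choose_spec

end GMT

end

theorem mainTheorem11 {n : ℕ} (hn : 2 ≤ n) (Ω : Set (GMT.Eucl n))
    (hΩ : GMT.IsMeasureDomain Ω) (hP : GMT.perimeter Ω univ < ∞)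
    (x : GMT.Eucl n) (hx : x ∈ GMT.reducedBoundary Ω) :
    x ∈ GMT.superReducedBoundary Ω ↔
      ∀ ε > (0 : ℝ), ∀ R > (0 : ℝ), ∃ r₀ > (0 : ℝ), ∀ r : ℝ, 0 < r → r < r₀ →
        ∀ y ∈ frontier (GMT.rescale Ω x r) ∩ GMT.tangentHalfSpace Ω x, ‖y‖ ≤ R →
          -GMT.signedDistFun (GMT.tangentHalfSpace Ω x) y ≤ ε * ‖y‖ := by
  -- The pair (m, σ) is taken from the witness for the chosen normal, so uniqueness of the normal is
  -- not needed.
  obtain ⟨hν, m, σ, hgrad, hlim⟩ := GMT.isOuterNormal_outerNormal hx.2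
  have hmeas : MeasurableSet Ω := hΩ.isOpen.measurableSet
  have hx0 : x ∉ GMT.densityPoints Ω 0 := fun h => hx.1 (Or.inl h)
  have hx1 : x ∉ GMT.densityPoints Ωᶜ 0 :=
    GMT.notMem_densityPoints_compl hmeas fun h => hx.1 (Or.inr h)
  have hlim' : Tendsto (fun r : ℝ => (m.real (Metric.ball x r))⁻¹ •
      ∫ y in Metric.ball x r, (-σ) y ∂m) (𝓝[>] 0) (𝓝 (-(-GMT.outerNormal Ω x))) := by
    simpa [integral_neg] using hlim.neg
  constructor
  · intro h ε hε R hR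
    exact GMT.frontier_subset_cone_of_tendstoLocallyUniformlyOn hν h.2 hε hR
  · intro hcone
    refine ⟨hx, GMT.tendstoLocallyUniformlyOn_signedDistFun hν hΩ.isOpen
      (fun p hp s hs => GMT.eventually_ball_inter_nonempty hgrad hν hmeas hlim hx0 hp hs)
      (fun p hp s hs => ?_) hcone⟩
    exact GMT.eventually_ball_inter_nonempty (hgrad.compl hmeas) (by rwa [norm_neg]) hmeas.compl
      hlim' hx1 (by rw [inner_neg_right]; linarith) hs
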